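/- Let $[a,b]$ be a compact interval and let $\mathcal F$ be the set of probability densities $f=e^{g}$ on $[a,b]$ (with respect to Lebesgue measure) with $g:[a,b]\to\mathbb R$ of bounded total variation. Fix $f_0\in\mathcal F$, let $P$ be the distribution with density $f_0$, and let $P_n$ be the empirical measure of $n$ independent random variables $X_1,\dots,X_n$ with distribution $P$. For $f\in\mathcal F$ put $$p_f=\tfrac12\log\frac{f+f_0}{2f_0},\qquad h(f,f_0)=\Big(\tfrac12\int_a^b(\sqrt f-\sqrt{f_0})^2\,dx\Big)^{1/2},\qquad J(f)=1+\operatorname{TV}(\log f)+\operatorname{TV}(\log f_0),$$ and let $$Z_n=\sup\left\{\frac{\sqrt n\,|(P_n-P)(p_f)|}{h^{1/2}(f,f_0)\,J^{1/2}(f)}\;:\; f\in\mathcal F,\ h(f,f_0)>n^{-1/3}J(f)\right\}\in[0,\infty],$$ with $\sup\emptyset=0$. Then there are constants $c>0$, $n_0\in\mathbb N$ and $t_0\in\mathbb R$ (which may depend on $f_0$) such that for all $n\ge n_0$ and all $T\ge t_0$ $$\mathbb P(Z_n\ge T)\le c\,\exp\left[-\frac{T}{c^2}\right].$$ In particular $Z_n=O_P(1)$: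 for an i.i.d. sequence $X_1,X_2,\dots$ with distribution $P$ and every $\varepsilon>0$ there are $M<\infty$ and $N\in\mathbb N$ with $\mathbb P(Z_n>M)<\varepsilon$ for all $n\ge N$. (If $Z_n$ is not measurable, $\mathbb P$ denotes outer probability.) -/

import Mathlib

open MeasureTheory ProbabilityTheory
open scoped ENNReal NNReal

noncomputable section

namespace FusedDensity

/-- Log-densities of bounded variation on the compact interval `[a, b]`:
`TV(g) < ∞` and `∫ e^g dx = 1`. Only the values of `g` on `[a, b]` matter. -/
def logDensities (a b : ℝ) : Set (ℝ → ℝ) :=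
  {g | BoundedVariationOn g (Set.Icc a b) ∧ ∫ x in Set.Icc a b, Real.exp (g x) = 1}

/-- The class `𝓕 = {e^g : g ∈ 𝓖}` of densities on `[a, b]` with log-bounded variation. -/
def densities (a b : ℝ) : Set (ℝ → ℝ) :=
  {f | ∃ g ∈ logDensities a b, f = fun x => Real.exp (g x)}

/-- `I(f) = TV(log f)`, the total variation over `[a, b]` (finite on `densities a b`). -/
def I (a b : ℝ) (f : ℝ → ℝ) : ℝ :=
  (eVariationOn (fun x => Real.log (f x)) (Set.Icc a b)).toReal

/-- `J(f) = 1 + I(f) + I(f₀)`. -/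
def J (a b : ℝ) (f₀ f : ℝ → ℝ) : ℝ := 1 + I a b f + I a b f₀

/-- The Hellinger distance `h(f, f₀)`, where `h² = ½ ∫ (√f - √f₀)² dx` over `[a, b]`. -/
def hellinger (a b : ℝ) (f f₀ : ℝ → ℝ) : ℝ :=
  √((1 / 2) * ∫ x in Set.Icc a b, (√(f x) - √(f₀ x)) ^ 2)

/-- `p_f = ½ log ((f + f₀) / (2 f₀))`. -/
def pFun (f₀ f : ℝ → ℝ) (x : ℝ) : ℝ := (1 / 2) * Real.log ((f x + f₀ x) / (2 * f₀ x))

/-- The distribution `P` on `[a, b]` with Lebesgue density `f₀`. -/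
def law (a b : ℝ) (f₀ : ℝ → ℝ) : Measure ℝ :=
  (volume.restrict (Set.Icc a b)).withDensity (fun x => ENNReal.ofReal (f₀ x))

/-- `P_n(g) = n⁻¹ ∑ g(x_i)`, the mean of `g` under the empirical measure of the sample `x`. -/
def empMean {n : ℕ} (x : Fin n → ℝ) (g : ℝ → ℝ) : ℝ := (n : ℝ)⁻¹ * ∑ i, g (x i)

/-- `√n |(P_n - P)(p_f)| / (h(f, f₀)^{1/2} J(f)^{1/2})`. -/
def ratio (a b : ℝ) (f₀ : ℝ → ℝ) {n : ℕ} (x : Fin n → ℝ) (f : ℝ → ℝ) : ℝ :=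
  √(n : ℝ) * |empMean x (pFun f₀ f) - ∫ y, pFun f₀ f y ∂(law a b f₀)| /
    (√(hellinger a b f f₀) * √(J a b f₀ f))

/-- The densities `f ∈ 𝓕` with `h(f, f₀) > n^{-1/3} J(f)`. -/
def farDensities (a b : ℝ) (f₀ : ℝ → ℝ) (n : ℕ) : Set (ℝ → ℝ) :=
  {f ∈ densities a b | (n : ℝ) ^ (-(1 / 3) : ℝ) * J a b f₀ f < hellinger a b f f₀}

/-- The supremum of `ratio` over `farDensities`, taken in `[0, ∞]`. -/
def supRatio (a b : ℝ) (f₀ : ℝ → ℝ) {n : ℕ} (x : Fin n → ℝ) : ℝ≥0∞ :=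
  ⨆ f ∈ farDensities a b f₀ n, ENNReal.ofReal (ratio a b f₀ x f)

/-- `X` is an i.i.d. family with common distribution of density `f₀` on `[a, b]`. -/
structure IsIIDSample {Ω ι : Type*} [MeasurableSpace Ω] (a b : ℝ) (f₀ : ℝ → ℝ) (μ : Measure Ω)
    (X : ι → Ω → ℝ) : Prop where
  indep : iIndepFun X μ
  hasLaw : ∀ i, HasLaw (X i) (law a b f₀) μ

/-- `Z_n = O_P(1)`. As a measure of an arbitrary set is its outer measure, `Z_n` need not be
measurable. -/
def IsBigOPOne {Ω : Type*} [MeasurableSpace Ω] (μ : Measure Ω) (Z : ℕ → Ω → ℝ≥0∞) : Prop :=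
  ∀ ε : ℝ, 0 < ε → ∃ (M : ℝ≥0) (N : ℕ), ∀ n ≥ N, μ {ω | (M : ℝ≥0∞) < Z n ω} < ENNReal.ofReal ε

end FusedDensity

end

/-!
The proof replaces entropy bounds by an explicit chain of step functions on nested grids, where the
level-`j` grid divides `[a, b)` into `16 ^ j` equal cells.

*Probability.* Only the deviations `D_jk = 4 ^ j √n (P_n - P)(cell j k)` of the cells matter. As
long as `16 ^ j ≤ n`, the sum of `± D_jk` over any `s` cells has exponential moment at most
`exp (C s)`, by independence of the sample (`lintegral_prod_exp_cell_le`). Expanding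
`∏ (1 + z exp (± D_jk))` turns this into a bound on the number of cells with
`± D_jk > T (i + 1)`: it exceeds `16 ^ j / 2 ^ i` with probability at most
`exp (- T (i + j + 1) / 4)` (`measure_countAbove_gt_le`). These probabilities are summable over the
levels `j`, the heights `i` and the two signs, with total at most `8 exp (- T / 4)`
(`measure_exceptionalSet_le`). Off the exceptional event `∑_k D_jk ^ 8` is of order
`T ^ 8 * 16 ^ j` at all levels (`sum_pow_eight_le`).

*Chaining.* On a sample off that event, let `g = p_f`, `M = J(f)` and `δ = h(f, f₀)`. The variation
of `g` is at most `M`, and its mean square is of order `δ ^ 2`. In each cell a point is chosen where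
`g ^ 2` is at most its mean over the cell, and `g_j` is the step function with these values. The
chain starts at the level `r` with `16 ^ r` of the order of `M / δ`. The term `g_r` is bounded by
the Cauchy–Schwarz inequality. For `g_{j+1} - g_j` the `ℓ¹` bound from the variation and the `ℓ²`
bound are interpolated against the eighth moment of the deviations, which gains a factor
`2 ^ (r - j)`, so that no logarithm is lost. The chain stops when `16 ^ j` reaches `n`, where the
remaining variation is negligible, because `h > n ^ (-1/3) J` means `(M / δ) ^ 3 < n`. The total is
of order `T M / 4 ^ r`, that is of order `T √(δ M)` (`abs_empDev_le_of_moments`), uniformly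
in `f`.
-/

noncomputable section

namespace FusedDensity

/-- The empirical process `√n (P_n - P)(u)`, evaluated at the sample `x` and the function `u`. -/
def empDev (P : Measure ℝ) {n : ℕ} (x : Fin n → ℝ) (u : ℝ → ℝ) : ℝ :=
  √(n : ℝ) * (empMean x u - ∫ y, u y ∂P)

/-! ### Exponential moments and the counting of large cell deviations -/

lemma integral_exp_le_exp_integral_sq {P : Measure ℝ} [IsProbabilityMeasure P] {φ : ℝ → ℝ}
    (hφ : Measurable φ) (hb : ∀ y, |φ y| ≤ 1) (h0 : ∫ y, φ y ∂P = 0) :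
    ∫ y, Real.exp (φ y) ∂P ≤ Real.exp (∫ y, φ y ^ 2 ∂P) := by
  have hi : Integrable φ P :=
    Integrable.of_bound hφ.aestronglyMeasurable 1 (by simpa using .of_forall hb)
  have hi2 : Integrable (fun y => φ y ^ 2) P :=
    Integrable.of_bound (hφ.pow_const 2).aestronglyMeasurable 1 (.of_forall fun y => by
      rw [Real.norm_eq_abs, abs_pow]; exact pow_le_one₀ (abs_nonneg _) (hb y))
  have hie : Integrable (fun y => Real.exp (φ y)) P :=
    Integrable.of_bound hφ.exp.aestronglyMeasurable (Real.exp 1) (.of_forall fun y => by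
      rw [Real.norm_eq_abs, Real.abs_exp]; exact Real.exp_le_exp.2 ((abs_le.1 (hb y)).2))
  calc ∫ y, Real.exp (φ y) ∂P ≤ ∫ y, (1 + φ y + φ y ^ 2) ∂P := by
        refine integral_mono hie (((integrable_const 1).add hi).add hi2) fun y => ?_
        have := (abs_le.1 (Real.abs_exp_sub_one_sub_id_le (hb y))).2
        simp only []
        linarith
    _ = ∫ y, φ y ^ 2 ∂P + 1 := by
        have h1 : Integrable (fun y => 1 + φ y) P := (integrable_const 1).add hi
        rw [integral_add h1 hi2, integral_add (integrable_const 1) hi, h0]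
        simp [add_comm]
    _ ≤ _ := Real.add_one_le_exp _

lemma integral_exp_centered_indicator_le {P : Measure ℝ} [IsProbabilityMeasure P] {A : Set ℝ}
    (hA : MeasurableSet A) {l : ℝ} (hl : |l| ≤ 1) :
    ∫ y, Real.exp (l * (A.indicator 1 y - P.real A)) ∂P ≤ Real.exp (l ^ 2 * P.real A) := by
  have hp0 : 0 ≤ P.real A := measureReal_nonneg
  have hp1 : P.real A ≤ 1 := measureReal_le_one
  have hm : Measurable (A.indicator (1 : ℝ → ℝ)) := measurable_one.indicator hA
  have hi : Integrable (A.indicator (1 : ℝ → ℝ)) P := (integrable_const 1).indicator hA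
  have hint : ∫ y, A.indicator (1 : ℝ → ℝ) y ∂P = P.real A := integral_indicator_one hA
  have hcases : ∀ y, A.indicator (1 : ℝ → ℝ) y = 0 ∨ A.indicator (1 : ℝ → ℝ) y = 1 := fun y => by
    by_cases h : y ∈ A <;> simp [h]
  refine (integral_exp_le_exp_integral_sq (φ := fun y => l * (A.indicator 1 y - P.real A))
    ((hm.sub_const _).const_mul _) (fun y => ?_) ?_).trans ?_
  · rw [abs_mul]
    refine mul_le_one₀ hl (abs_nonneg _) (abs_le.2 ?_)
    rcases hcases y with h | h <;> rw [h] <;> constructor <;> linarith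
  · rw [integral_const_mul, integral_sub hi (integrable_const _), hint]
    simp
  · refine Real.exp_le_exp.2 ?_
    have : ∀ y, (l * (A.indicator (1 : ℝ → ℝ) y - P.real A)) ^ 2 =
        l ^ 2 * ((1 - 2 * P.real A) * A.indicator (1 : ℝ → ℝ) y + P.real A ^ 2) := fun y => by
      rcases hcases y with h | h <;> rw [h] <;> ring
    simp_rw [this]
    rw [integral_const_mul, integral_add (hi.const_mul _) (integrable_const _),
      integral_const_mul, hint]
    simp only [integral_const, probReal_univ, smul_eq_mul, one_mul]
    exact mul_le_mul_of_nonneg_left (by nlinarith) (sq_nonneg l)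

lemma lintegral_exp_sum_centered_indicator_le {P : Measure ℝ} [IsProbabilityMeasure P] {A : Set ℝ}
    (hA : MeasurableSet A) {l : ℝ} (hl : |l| ≤ 1) (n : ℕ) :
    ∫⁻ x, ENNReal.ofReal (Real.exp (l * ∑ i, (A.indicator 1 (x i) - P.real A)))
        ∂(Measure.pi fun _ : Fin n => P) ≤
      ENNReal.ofReal (Real.exp (n * (l ^ 2 * P.real A))) := by
  have hprod : ∀ x : Fin n → ℝ, Real.exp (l * ∑ i, (A.indicator 1 (x i) - P.real A)) =
      ∏ i, Real.exp (l * (A.indicator 1 (x i) - P.real A)) := fun x => by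
    rw [Finset.mul_sum, Real.exp_sum]
  have hm : Measurable (fun y => Real.exp (l * (A.indicator (1 : ℝ → ℝ) y - P.real A))) :=
    (((measurable_one.indicator hA).sub_const _).const_mul _).exp
  have hi : Integrable (fun y => Real.exp (l * (A.indicator (1 : ℝ → ℝ) y - P.real A))) P := by
    refine Integrable.of_bound hm.aestronglyMeasurable (Real.exp 1) (.of_forall fun y => ?_)
    rw [Real.norm_eq_abs, Real.abs_exp]
    refine Real.exp_le_exp.2 ((le_abs_self _).trans ?_)
    rw [abs_mul]
    refine mul_le_one₀ hl (abs_nonneg _) (abs_le.2 ?_)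
    have hp0 : 0 ≤ P.real A := measureReal_nonneg
    have hp1 : P.real A ≤ 1 := measureReal_le_one
    by_cases h : y ∈ A
    · simp only [h, Set.indicator_of_mem, Pi.one_apply]
      constructor <;> linarith
    · simp only [h, not_false_eq_true, Set.indicator_of_notMem]
      constructor <;> linarith
  simp_rw [hprod]
  rw [← ofReal_integral_eq_lintegral_ofReal (Integrable.fintype_prod (fun _ => hi))
    (.of_forall fun x => Finset.prod_nonneg fun i _ => (Real.exp_pos _).le)]
  refine ENNReal.ofReal_le_ofReal ?_
  rw [integral_fintype_prod_eq_prod (fun (_ : Fin n) y =>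
    Real.exp (l * (A.indicator (1 : ℝ → ℝ) y - P.real A)))]
  rw [Finset.prod_const, Finset.card_univ, Fintype.card_fin, Real.exp_nat_mul]
  exact pow_le_pow_left₀ (integral_nonneg fun y => (Real.exp_pos _).le)
    (integral_exp_centered_indicator_le hA hl) n

lemma sqrt_mul_empDev_indicator {P : Measure ℝ} {n m : ℕ} (hn : 0 < n) (x : Fin n → ℝ)
    {A : Set ℝ} (hA : MeasurableSet A) :
    √(m : ℝ) * empDev P x (A.indicator 1) =
      √(m / n : ℝ) * ∑ i, (A.indicator 1 (x i) - P.real A) := by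
  have hn' : (0 : ℝ) < n := Nat.cast_pos.2 hn
  have hs : √(n : ℝ) * √(n : ℝ) = n := Real.mul_self_sqrt hn'.le
  have hs0 : √(n : ℝ) ≠ 0 := (Real.sqrt_pos.2 hn').ne'
  have hint : ∫ y, A.indicator (1 : ℝ → ℝ) y ∂P = P.real A := integral_indicator_one hA
  rw [empDev, empMean, hint, Real.sqrt_div (Nat.cast_nonneg m), Finset.sum_sub_distrib]
  simp only [Finset.sum_const, Finset.card_univ, Fintype.card_fin, nsmul_eq_mul]
  generalize ∑ i, A.indicator (1 : ℝ → ℝ) (x i) = s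
  field_simp
  rw [show √(n : ℝ) ^ 2 = n by rw [sq, hs]]

/-- Although the deviations of different cells are dependent, the exponential moment of a sum of
normalized deviations over disjoint cells is bounded by one factor `exp C` per cell: the sum is the
deviation of the union of the cells, and `m ≤ n` keeps the summands of its centered binomial
variable at most `1` in absolute value. -/
lemma lintegral_prod_exp_cell_le {P : Measure ℝ} [IsProbabilityMeasure P] {n m : ℕ} (hm : 0 < m)
    (hmn : m ≤ n) {A : ℕ → Set ℝ} (hA : ∀ k, MeasurableSet (A k))
    (hdisj : Pairwise (Function.onFun Disjoint A)) {C : ℝ} (S : Finset ℕ)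
    (hC : ∀ k ∈ S, P.real (A k) ≤ C / m) {e : ℝ} (he : |e| = 1) :
    ∫⁻ x, ∏ k ∈ S, ENNReal.ofReal
        (Real.exp (e * (√(m : ℝ) * empDev P x ((A k).indicator 1))))
        ∂(Measure.pi fun _ : Fin n => P) ≤ ENNReal.ofReal (Real.exp C) ^ S.card := by
  have hn : 0 < n := hm.trans_le hmn
  have hm' : (0 : ℝ) < m := Nat.cast_pos.2 hm
  have hn' : (0 : ℝ) < n := Nat.cast_pos.2 hn
  set B : Set ℝ := ⋃ k ∈ S, A k with hB
  have hBm : MeasurableSet B := Finset.measurableSet_biUnion S fun k _ => hA k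
  have hind : ∀ y, B.indicator (1 : ℝ → ℝ) y = ∑ k ∈ S, (A k).indicator 1 y := fun y => by
    rw [hB, Finset.indicator_biUnion S A (fun i _ j _ hij => hdisj hij)]
  have hPB : P.real B = ∑ k ∈ S, P.real (A k) :=
    measureReal_biUnion_finset (fun i _ j _ hij => hdisj hij) fun k _ => hA k
  have hsum : ∀ x : Fin n → ℝ, ∏ k ∈ S, ENNReal.ofReal
        (Real.exp (e * (√(m : ℝ) * empDev P x ((A k).indicator 1)))) =
      ENNReal.ofReal (Real.exp ((e * √(m / n : ℝ)) * ∑ i, (B.indicator 1 (x i) - P.real B))) := by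
    intro x
    rw [← ENNReal.ofReal_prod_of_nonneg (fun _ _ => (Real.exp_pos _).le), ← Real.exp_sum]
    congr 2
    simp_rw [sqrt_mul_empDev_indicator hn x (hA _), hind, hPB, ← Finset.sum_sub_distrib]
    rw [Finset.sum_comm, Finset.mul_sum]
    exact Finset.sum_congr rfl fun k _ => by ring
  simp_rw [hsum]
  have hl2 : (e * √(m / n : ℝ)) ^ 2 = m / n := by
    rw [mul_pow, ← sq_abs e, he, Real.sq_sqrt (by positivity)]; ring
  refine (lintegral_exp_sum_centered_indicator_le hBm ?_ n).trans ?_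
  · rw [← sq_le_one_iff_abs_le_one, hl2]
    exact (div_le_one hn').2 (Nat.cast_le.2 hmn)
  · rw [← ENNReal.ofReal_pow (Real.exp_pos _).le, ← Real.exp_nat_mul]
    refine ENNReal.ofReal_le_ofReal (Real.exp_le_exp.2 ?_)
    rw [hl2, hPB]
    calc (n : ℝ) * (m / n * ∑ k ∈ S, P.real (A k)) = m * ∑ k ∈ S, P.real (A k) := by field_simp
      _ ≤ m * ∑ k ∈ S, C / m := by gcongr with k hk; exact hC k hk
      _ = S.card * C := by rw [Finset.sum_const, nsmul_eq_mul]; field_simp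

lemma lintegral_prod_one_add_le {Ω : Type*} [MeasurableSpace Ω] {μ : Measure Ω} {Y : ℕ → Ω → ℝ≥0∞}
    (hY : ∀ k, Measurable (Y k)) (K : Finset ℕ) (a z : ℝ≥0∞)
    (h : ∀ S ⊆ K, ∫⁻ ω, ∏ k ∈ S, Y k ω ∂μ ≤ a ^ S.card) :
    ∫⁻ ω, ∏ k ∈ K, (1 + z * Y k ω) ∂μ ≤ (1 + z * a) ^ K.card := by
  simp_rw [Finset.prod_one_add, Finset.prod_mul_distrib, Finset.prod_const]
  rw [lintegral_finsetSum _ (fun S _ => (Finset.measurable_prod S fun k _ => hY k).const_mul _)]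
  calc ∑ S ∈ K.powerset, ∫⁻ ω, z ^ S.card * ∏ k ∈ S, Y k ω ∂μ
      ≤ ∑ S ∈ K.powerset, (z * a) ^ S.card * 1 ^ (K.card - S.card) := by
        refine Finset.sum_le_sum fun S hS => ?_
        rw [lintegral_const_mul _ (Finset.measurable_prod S fun k _ => hY k), one_pow, mul_one,
          mul_pow]
        gcongr
        exact h S (Finset.mem_powerset.1 hS)
    _ = _ := by rw [Finset.sum_pow_mul_eq_add_pow, add_comm]

/-- Number of indices `k < m` with `u < d k`. -/
def countAbove (m : ℕ) (u : ℝ) (d : ℕ → ℝ) : ℕ := {k ∈ Finset.range m | u < d k}.card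

lemma pow_countAbove_le_prod (m : ℕ) (u : ℝ) (d : ℕ → ℝ) (z : ℝ) :
    (ENNReal.ofReal (z * Real.exp u)) ^ countAbove m u d ≤
      ∏ k ∈ Finset.range m, (1 + ENNReal.ofReal z * ENNReal.ofReal (Real.exp (d k))) := by
  rw [countAbove, ← Finset.prod_const]
  refine le_trans (Finset.prod_le_prod' (fun k hk => ?_))
    (Finset.prod_le_prod_of_subset_of_one_le' (Finset.filter_subset _ _) fun k _ _ => le_self_add)
  rw [ENNReal.ofReal_mul' (Real.exp_pos _).le]
  refine le_add_left ?_
  gcongr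
  exact (Finset.mem_filter.1 hk).2.le

/-- The exponent in Markov's inequality for `∏ (1 + z exp D_k)` with `z = 2 ^ (-i)`. The maximum
with `1` reflects that a count is an integer; it is what makes the bound summable in the level `j`
as well, since there are `16 ^ j / 2 ^ i ≥ 8 ^ j` cells to beat when `i < j`. -/
lemma exponent_bound {i j : ℕ} {T C : ℝ} (hC : 1 ≤ C) (hT : 2 * (1 + C) ≤ T) :
    16 ^ j * (1 / 2 ^ i) * C + T * (i + j + 1) / 4 ≤
      max 1 (16 ^ j / 2 ^ i) * (T * (i + 1) - i * Real.log 2) := by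
  set s : ℝ := max 1 (16 ^ j / 2 ^ i) with hs
  have hs1 : 1 ≤ s := le_max_left _ _
  have hsm : (16 : ℝ) ^ j * (1 / 2 ^ i) ≤ s := by
    rw [mul_one_div]; exact le_max_right _ _
  have hi : (0 : ℝ) ≤ i := Nat.cast_nonneg i
  have hj : (0 : ℝ) ≤ j := Nat.cast_nonneg j
  have hkey : ((i : ℝ) + j + 1) / 2 ≤ s * (i + 1) := by
    rcases le_or_gt j i with hij | hij
    · have : (j : ℝ) ≤ i := Nat.cast_le.2 hij
      nlinarith
    · have h1 : (j : ℝ) + 1 ≤ s := by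
        have h2 : (2 : ℝ) ^ i ≤ 2 ^ j := pow_le_pow_right₀ (by norm_num) hij.le
        have h3 : (8 : ℝ) ^ j ≤ 16 ^ j / 2 ^ i := by
          rw [le_div_iff₀ (by positivity)]
          calc (8 : ℝ) ^ j * 2 ^ i ≤ 8 ^ j * 2 ^ j := by gcongr
            _ = 16 ^ j := by rw [← mul_pow]; norm_num
        have h4 := one_add_mul_le_pow (a := (7 : ℝ)) (by norm_num) j
        norm_num at h4
        linarith [h3.trans (le_max_right 1 _)]
      nlinarith
  have hlog : Real.log 2 ≤ 1 := by linarith [Real.log_two_lt_d9]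
  have h5 : 16 ^ j * (1 / 2 ^ i) * C ≤ s * C := by gcongr
  have h6 : T * (i + j + 1) / 4 ≤ s * (T / 2 * (i + 1)) := by nlinarith
  have h7 : s * (C + T / 2 * (i + 1)) ≤ s * (T * (i + 1) - i * Real.log 2) := by
    gcongr
    nlinarith
  linarith

/-- Product trick: the expectation of `∏ (1 + z exp D_k)` controls all sub-products at once, so the
number of large `D_k` has exponentially small probability of exceeding `16 ^ j / 2 ^ i`. -/
lemma measure_countAbove_gt_le {Ω : Type*} [MeasurableSpace Ω] {μ : Measure Ω} {D : ℕ → Ω → ℝ}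
    (hD : ∀ k, Measurable (D k)) {j : ℕ} {C : ℝ} (hC0 : 0 ≤ C)
    (h : ∀ S ⊆ Finset.range (16 ^ j),
      ∫⁻ ω, ∏ k ∈ S, ENNReal.ofReal (Real.exp (D k ω)) ∂μ ≤ ENNReal.ofReal (Real.exp C) ^ S.card)
    (i : ℕ) {T : ℝ} (hT : 2 * (1 + Real.exp C) ≤ T) :
    μ {ω | (16 : ℝ) ^ j / 2 ^ i < countAbove (16 ^ j) (T * (i + 1)) (fun k => D k ω)} ≤
      ENNReal.ofReal (Real.exp (-(T * (i + j + 1) / 4))) := by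
  set z : ℝ := 1 / 2 ^ i with hz
  have hz0 : 0 < z := by positivity
  have hzlog : z = Real.exp (-(i * Real.log 2)) := by
    rw [Real.exp_neg, Real.exp_nat_mul, Real.exp_log (by norm_num), hz, one_div]
  set s : ℝ := max 1 (16 ^ j / 2 ^ i) with hs
  set b : ℝ := T * (i + 1) - i * Real.log 2 with hb
  have hE1 : 1 ≤ Real.exp C := Real.one_le_exp hC0
  have hb0 : 0 ≤ b := by
    have hlog : Real.log 2 ≤ 1 := by linarith [Real.log_two_lt_d9]
    have hi : (0 : ℝ) ≤ i := Nat.cast_nonneg i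
    nlinarith
  have hYm : ∀ k, Measurable fun ω => ENNReal.ofReal (Real.exp (D k ω)) :=
    fun k => (hD k).exp.ennreal_ofReal
  have hle := lintegral_prod_one_add_le hYm (Finset.range (16 ^ j)) _ (ENNReal.ofReal z) h
  have hsub : {ω | (16 : ℝ) ^ j / 2 ^ i < countAbove (16 ^ j) (T * (i + 1)) (fun k => D k ω)} ⊆
      {ω | ENNReal.ofReal (Real.exp (s * b)) ≤ ∏ k ∈ Finset.range (16 ^ j),
        (1 + ENNReal.ofReal z * ENNReal.ofReal (Real.exp (D k ω)))} := by
    intro ω hω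
    simp only [Set.mem_ofPred_eq] at hω ⊢
    refine le_trans ?_ (pow_countAbove_le_prod (16 ^ j) (T * (i + 1)) (fun k => D k ω) z)
    rw [hzlog, ← Real.exp_add, show -(i * Real.log 2) + T * (i + 1) = b by rw [hb]; ring,
      ← ENNReal.ofReal_pow (Real.exp_pos _).le, ← Real.exp_nat_mul]
    refine ENNReal.ofReal_le_ofReal (Real.exp_le_exp.2 ?_)
    gcongr
    refine max_le ?_ hω.le
    have : (0 : ℝ) < countAbove (16 ^ j) (T * (i + 1)) (fun k => D k ω) :=
      lt_of_le_of_lt (by positivity) hω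
    exact_mod_cast (Nat.cast_pos.1 this)
  have hmeas : AEMeasurable (fun ω => ∏ k ∈ Finset.range (16 ^ j),
        (1 + ENNReal.ofReal z * ENNReal.ofReal (Real.exp (D k ω)))) μ :=
    (Finset.measurable_prod _ fun k _ => ((hYm k).const_mul _).const_add _).aemeasurable
  refine (measure_mono hsub).trans ((meas_ge_le_lintegral_div hmeas
    (by simpa using Real.exp_pos _) ENNReal.ofReal_ne_top).trans ?_)
  rw [ENNReal.div_le_iff (by simpa using Real.exp_pos _) ENNReal.ofReal_ne_top,
    ← ENNReal.ofReal_mul (Real.exp_pos _).le, ← Real.exp_add]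
  refine hle.trans ?_
  rw [Finset.card_range, ← ENNReal.ofReal_mul hz0.le, ← ENNReal.ofReal_one,
    ← ENNReal.ofReal_add zero_le_one (by positivity), ← ENNReal.ofReal_pow (by positivity)]
  refine ENNReal.ofReal_le_ofReal ?_
  calc (1 + z * Real.exp C) ^ 16 ^ j ≤ Real.exp (z * Real.exp C) ^ 16 ^ j := by
        gcongr
        linarith [Real.add_one_le_exp (z * Real.exp C)]
    _ = Real.exp (16 ^ j * (1 / 2 ^ i) * Real.exp C) := by
        rw [← Real.exp_nat_mul, hz]; push_cast; ring_nf
    _ ≤ _ := Real.exp_le_exp.2 (by linarith [exponent_bound (i := i) (j := j) hE1 hT])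

/-- The constant relating cell counts to eighth moments: the sum over the layers
`T (i + 1) < |d| ≤ T (i + 2)`, each with at most `16 ^ j / 2 ^ i` cells for either sign. -/
def momentConst : ℝ := 2 * (1 + ∑' i : ℕ, ((i : ℝ) + 2) ^ 8 * (1 / 2) ^ i)

lemma summable_moment : Summable fun i : ℕ => ((i : ℝ) + 2) ^ 8 * (1 / 2 : ℝ) ^ i := by
  have h := (summable_nat_add_iff (f := fun i : ℕ => (i : ℝ) ^ 8 * (1 / 2 : ℝ) ^ i) 2).2
    (summable_pow_mul_geometric_of_norm_lt_one 8 (by norm_num))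
  refine (h.mul_left 4).congr fun i => ?_
  push_cast
  rw [pow_add]; ring

lemma one_le_momentConst : 1 ≤ momentConst := by
  have : 0 ≤ ∑' i : ℕ, ((i : ℝ) + 2) ^ 8 * (1 / 2 : ℝ) ^ i := tsum_nonneg fun i => by positivity
  rw [momentConst]; linarith

lemma sum_pos_pow_eight_le {j : ℕ} {T : ℝ} (hT : 0 < T) {d : ℕ → ℝ}
    (h : ∀ i : ℕ, (countAbove (16 ^ j) (T * (i + 1)) d : ℝ) ≤ 16 ^ j / 2 ^ i) :
    ∑ k ∈ Finset.range (16 ^ j), (max (d k) 0) ^ 8 ≤ momentConst / 2 * T ^ 8 * 16 ^ j := by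
  have hpt : ∀ k ∈ Finset.range (16 ^ j), (max (d k) 0) ^ 8 ≤ T ^ 8 * (1 +
      ∑ i ∈ Finset.range (4 * j + 1), if T * (i + 1) < d k then ((i : ℝ) + 2) ^ 8 else 0) := by
    intro k hk
    have hnn : ∀ i ∈ Finset.range (4 * j + 1),
        (0 : ℝ) ≤ if T * (i + 1) < d k then ((i : ℝ) + 2) ^ 8 else 0 :=
      fun i _ => by split_ifs <;> positivity
    rcases le_or_gt (d k) T with hd | hd
    · calc (max (d k) 0) ^ 8 ≤ T ^ 8 := by gcongr; exact max_le hd hT.le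
        _ ≤ _ := le_mul_of_one_le_right (by positivity) (by linarith [Finset.sum_nonneg hnn])
    · -- `p` is the layer of `d k`, that is `T * (p + 1) < d k ≤ T * (p + 2)`
      obtain ⟨p, hp⟩ : ∃ p : ℕ, p + 1 = ⌈d k / T⌉₊ - 1 := by
        have h1 : 1 < ⌈d k / T⌉₊ := Nat.lt_ceil.2 (by simpa using (one_lt_div hT).2 hd)
        exact ⟨⌈d k / T⌉₊ - 2, by omega⟩
      have hp1 : T * ((p : ℝ) + 1) < d k := by
        have : p + 1 < ⌈d k / T⌉₊ := by omega
        rw [Nat.lt_ceil, lt_div_iff₀ hT] at this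
        push_cast at this; linarith
      have hp2 : d k ≤ T * ((p : ℝ) + 2) := by
        have : ⌈d k / T⌉₊ ≤ p + 2 := by omega
        rw [Nat.ceil_le, div_le_iff₀ hT] at this
        push_cast at this; linarith
      have hpj : p ∈ Finset.range (4 * j + 1) := by
        by_contra hcon
        have hp' : 4 * j + 1 ≤ p := by simpa using hcon
        have hc : (1 : ℝ) ≤ countAbove (16 ^ j) (T * (p + 1)) d := by
          rw [Nat.one_le_cast, countAbove, Nat.one_le_iff_ne_zero, Finset.card_ne_zero]
          exact ⟨k, Finset.mem_filter.2 ⟨hk, hp1⟩⟩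
        have h2 : (16 : ℝ) ^ j / 2 ^ p < 1 := by
          rw [div_lt_one (by positivity), show (16 : ℝ) = 2 ^ 4 by norm_num, ← pow_mul]
          exact pow_lt_pow_right₀ (by norm_num) (by omega)
        linarith [h p]
      have h3 : ((p : ℝ) + 2) ^ 8 ≤
          ∑ i ∈ Finset.range (4 * j + 1), if T * (i + 1) < d k then ((i : ℝ) + 2) ^ 8 else 0 := by
        have := Finset.single_le_sum hnn hpj
        simpa [hp1] using this
      calc (max (d k) 0) ^ 8 ≤ (T * ((p : ℝ) + 2)) ^ 8 := by
            gcongr; exact max_le hp2 (by positivity)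
        _ = T ^ 8 * ((p : ℝ) + 2) ^ 8 := mul_pow _ _ _
        _ ≤ _ := by gcongr; linarith
  calc _ ≤ ∑ k ∈ Finset.range (16 ^ j), T ^ 8 * (1 +
      ∑ i ∈ Finset.range (4 * j + 1), if T * (i + 1) < d k then ((i : ℝ) + 2) ^ 8 else 0) :=
        Finset.sum_le_sum hpt
    _ = T ^ 8 * (16 ^ j + ∑ i ∈ Finset.range (4 * j + 1),
          ((i : ℝ) + 2) ^ 8 * countAbove (16 ^ j) (T * (i + 1)) d) := by
        rw [← Finset.mul_sum, Finset.sum_add_distrib, Finset.sum_comm]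
        congr 2
        · simp
        · refine Finset.sum_congr rfl fun i _ => ?_
          rw [← Finset.sum_filter, Finset.sum_const, nsmul_eq_mul, mul_comm, countAbove]
    _ ≤ T ^ 8 * (16 ^ j + ∑ i ∈ Finset.range (4 * j + 1),
          ((i : ℝ) + 2) ^ 8 * (16 ^ j / 2 ^ i)) := by gcongr with i _; exact h i
    _ = T ^ 8 * (16 ^ j * (1 + ∑ i ∈ Finset.range (4 * j + 1),
          ((i : ℝ) + 2) ^ 8 * (1 / 2) ^ i)) := by
        rw [mul_add (16 ^ j : ℝ), Finset.mul_sum, mul_one]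
        congr 2
        exact Finset.sum_congr rfl fun i _ => by rw [one_div, inv_pow]; ring
    _ ≤ T ^ 8 * (16 ^ j * (1 + ∑' i : ℕ, ((i : ℝ) + 2) ^ 8 * (1 / 2) ^ i)) := by
        gcongr
        exact summable_moment.sum_le_tsum _ fun i _ => by positivity
    _ = _ := by rw [momentConst]; ring

lemma sum_pow_eight_le {j : ℕ} {T : ℝ} (hT : 0 < T) {d : ℕ → ℝ}
    (h₁ : ∀ i : ℕ, (countAbove (16 ^ j) (T * (i + 1)) d : ℝ) ≤ 16 ^ j / 2 ^ i)
    (h₂ : ∀ i : ℕ, (countAbove (16 ^ j) (T * (i + 1)) (fun k => -d k) : ℝ) ≤ 16 ^ j / 2 ^ i) :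
    ∑ k ∈ Finset.range (16 ^ j), d k ^ 8 ≤ momentConst * T ^ 8 * 16 ^ j := by
  have h3 := sum_pos_pow_eight_le hT h₁
  have h4 := sum_pos_pow_eight_le hT h₂
  have : ∀ k ∈ Finset.range (16 ^ j), d k ^ 8 ≤ (max (d k) 0) ^ 8 + (max (-d k) 0) ^ 8 := by
    intro k _
    rcases le_total 0 (d k) with hd | hd
    · rw [max_eq_left hd]; have : 0 ≤ (max (-d k) 0) ^ 8 := by positivity
      linarith
    · rw [max_eq_left (neg_nonneg.2 hd), Even.neg_pow (by decide)]
      have : 0 ≤ (max (d k) 0) ^ 8 := by positivity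
      linarith
  refine (Finset.sum_le_sum this).trans ?_
  rw [Finset.sum_add_distrib]
  linarith

/-! ### The grid of nested cells -/

/-- Index of the level-`j` cell of `x`, for the division of `[a, b)` into `16 ^ j` equal cells. -/
def cellIndex (a b : ℝ) (j : ℕ) (x : ℝ) : ℕ := ⌊16 ^ j * ((x - a) / (b - a))⌋₊

/-- The `k`-th level-`j` cell of `[a, b)`, empty for `16 ^ j ≤ k`. The base `16` makes all the
fractional powers of the mesh used in the chaining argument integral powers of `2`. -/
def cell (a b : ℝ) (j k : ℕ) : Set ℝ := {x ∈ Set.Ico a b | cellIndex a b j x = k}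

/-- The step function with value `φ k` on the `k`-th level-`j` cell, and `0` off `[a, b)`. -/
def stepFun (a b : ℝ) (j : ℕ) (φ : ℕ → ℝ) (x : ℝ) : ℝ :=
  ∑ k ∈ Finset.range (16 ^ j), φ k * (cell a b j k).indicator 1 x

variable {a b : ℝ}

lemma cellIndex_lt (hab : a < b) (j : ℕ) {x : ℝ} (hx : x ∈ Set.Ico a b) :
    cellIndex a b j x < 16 ^ j := by
  have hba : 0 < b - a := sub_pos.2 hab
  rw [cellIndex, Nat.floor_lt (mul_nonneg (by positivity)
    (div_nonneg (sub_nonneg.2 hx.1) hba.le))]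
  push_cast
  exact mul_lt_of_lt_one_right (by positivity) ((div_lt_one hba).2 (by linarith [hx.2]))

lemma cellIndex_succ_div (a b : ℝ) (j : ℕ) (x : ℝ) :
    cellIndex a b (j + 1) x / 16 = cellIndex a b j x := by
  have := Nat.floor_div_natCast (16 ^ (j + 1) * ((x - a) / (b - a))) 16
  rw [cellIndex, cellIndex, ← this]
  congr 1
  push_cast
  ring

lemma cellIndex_mono (hab : a < b) (j : ℕ) : Monotone (cellIndex a b j) := fun x y hxy => by
  have hba : 0 < b - a := sub_pos.2 hab
  unfold cellIndex
  gcongr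

lemma measurable_cellIndex (a b : ℝ) (j : ℕ) : Measurable (cellIndex a b j) :=
  Nat.measurable_floor.comp (((measurable_id.sub_const a).div_const _).const_mul _)

lemma measurableSet_cell (a b : ℝ) (j k : ℕ) : MeasurableSet (cell a b j k) :=
  measurableSet_Ico.inter (measurable_cellIndex a b j (measurableSet_singleton k))

lemma pairwise_disjoint_cell (a b : ℝ) (j : ℕ) :
    Pairwise (Function.onFun Disjoint (cell a b j)) := fun _ _ h =>
  Set.disjoint_left.2 fun _ hx hy => h (hx.2.symm.trans hy.2)

lemma cell_subset_Ico (a b : ℝ) (j k : ℕ) : cell a b j k ⊆ Set.Ico a b := fun _ hx => hx.1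

lemma cell_subset_Icc (a b : ℝ) (j k : ℕ) : cell a b j k ⊆ Set.Icc a b :=
  (cell_subset_Ico a b j k).trans Set.Ico_subset_Icc_self

lemma cell_succ_subset (a b : ℝ) (j k : ℕ) : cell a b (j + 1) k ⊆ cell a b j (k / 16) :=
  fun x hx => ⟨hx.1, by rw [← cellIndex_succ_div, hx.2]⟩

lemma cell_eq_Ico (hab : a < b) {j k : ℕ} (hk : k < 16 ^ j) :
    cell a b j k = Set.Ico (a + (b - a) * (k / 16 ^ j)) (a + (b - a) * ((k + 1) / 16 ^ j)) := by
  have hba : 0 < b - a := sub_pos.2 hab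
  have hm : (0 : ℝ) < 16 ^ j := by positivity
  have hk' : (k : ℝ) + 1 ≤ 16 ^ j := by exact_mod_cast hk
  have key : ∀ x, a ≤ x → (cellIndex a b j x = k ↔ a + (b - a) * (k / 16 ^ j) ≤ x ∧
      x < a + (b - a) * ((k + 1) / 16 ^ j)) := fun x hx => by
    rw [cellIndex, Nat.floor_eq_iff (mul_nonneg hm.le (div_nonneg (sub_nonneg.2 hx) hba.le)),
      mul_div_assoc', le_div_iff₀ hba, div_lt_iff₀ hba]
    refine and_congr ?_ ?_
    · rw [← sub_nonneg, ← sub_nonneg (a := x), show 16 ^ j * (x - a) - k * (b - a) =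
        (x - (a + (b - a) * (k / 16 ^ j))) * 16 ^ j by field_simp; ring]
      exact mul_nonneg_iff_of_pos_right hm
    · rw [← sub_pos, ← sub_pos (b := x), show (k + 1) * (b - a) - 16 ^ j * (x - a) =
        (a + (b - a) * ((k + 1) / 16 ^ j) - x) * 16 ^ j by field_simp; ring]
      exact mul_pos_iff_of_pos_right hm
  ext x
  constructor
  · rintro ⟨hx, h⟩
    exact (key x hx.1).1 h
  · intro hx
    have h0 : 0 ≤ (b - a) * (k / 16 ^ j) := by positivity
    have h1 : (b - a) * ((k + 1) / 16 ^ j) ≤ b - a :=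
      mul_le_of_le_one_right hba.le ((div_le_one hm).2 hk')
    have hax : a ≤ x := by linarith [hx.1]
    exact ⟨⟨hax, by linarith [hx.2]⟩, (key x hax).2 hx⟩

lemma volume_cell (hab : a < b) {j k : ℕ} (hk : k < 16 ^ j) :
    volume (cell a b j k) = ENNReal.ofReal ((b - a) / 16 ^ j) := by
  rw [cell_eq_Ico hab hk, Real.volume_Ico]
  congr 1
  ring

lemma stepFun_apply (hab : a < b) (j : ℕ) (φ : ℕ → ℝ) {x : ℝ} (hx : x ∈ Set.Ico a b) :
    stepFun a b j φ x = φ (cellIndex a b j x) := by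
  rw [stepFun, Finset.sum_eq_single (cellIndex a b j x)]
  · rw [Set.indicator_of_mem (show x ∈ cell a b j _ from ⟨hx, rfl⟩)]
    simp
  · intro k _ hk
    rw [Set.indicator_of_notMem fun h => hk h.2.symm, mul_zero]
  · intro h
    exact absurd (Finset.mem_range.2 (cellIndex_lt hab j hx)) h

lemma stepFun_eq_zero (j : ℕ) (φ : ℕ → ℝ) {x : ℝ} (hx : x ∉ Set.Ico a b) :
    stepFun a b j φ x = 0 :=
  Finset.sum_eq_zero fun k _ => by
    rw [Set.indicator_of_notMem fun h => hx h.1, mul_zero]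

lemma stepFun_succ_sub (hab : a < b) (j : ℕ) (φ ψ : ℕ → ℝ) :
    (fun x => stepFun a b (j + 1) φ x - stepFun a b j ψ x) =
      stepFun a b (j + 1) fun k => φ k - ψ (k / 16) := by
  funext x
  by_cases hx : x ∈ Set.Ico a b
  · simp only [stepFun_apply hab _ _ hx, cellIndex_succ_div]
  · simp only [stepFun_eq_zero _ _ hx, sub_zero]

lemma integrable_indicator_cell (P : Measure ℝ) [IsFiniteMeasure P] (j k : ℕ) :
    Integrable ((cell a b j k).indicator (1 : ℝ → ℝ)) P :=
  (integrable_const (1 : ℝ)).indicator (measurableSet_cell a b j k)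

lemma integrable_stepFun (P : Measure ℝ) [IsFiniteMeasure P] (j : ℕ) (φ : ℕ → ℝ) :
    Integrable (stepFun a b j φ) P :=
  integrable_finsetSum _ fun k _ => (integrable_indicator_cell P j k).const_mul (φ k)

lemma empDev_sub (P : Measure ℝ) {n : ℕ} (x : Fin n → ℝ) {u v : ℝ → ℝ} (hu : Integrable u P)
    (hv : Integrable v P) :
    empDev P x (fun y => u y - v y) = empDev P x u - empDev P x v := by
  simp only [empDev, empMean, integral_sub hu hv, Finset.sum_sub_distrib]
  ring

lemma empDev_stepFun (P : Measure ℝ) [IsFiniteMeasure P] {n : ℕ} (x : Fin n → ℝ) (j : ℕ)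
    (φ : ℕ → ℝ) : empDev P x (stepFun a b j φ) =
      ∑ k ∈ Finset.range (16 ^ j), φ k * empDev P x ((cell a b j k).indicator 1) := by
  have h1 : ∫ y, stepFun a b j φ y ∂P = ∑ k ∈ Finset.range (16 ^ j),
      φ k * ∫ y, (cell a b j k).indicator (1 : ℝ → ℝ) y ∂P := by
    unfold stepFun
    rw [integral_finsetSum _ fun k _ => (integrable_indicator_cell P j k).const_mul (φ k)]
    exact Finset.sum_congr rfl fun k _ => integral_const_mul _ _
  simp only [empDev, empMean, h1]
  simp only [stepFun]
  rw [Finset.sum_comm, Finset.mul_sum, ← Finset.sum_sub_distrib, Finset.mul_sum]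
  refine Finset.sum_congr rfl fun k _ => ?_
  rw [← Finset.mul_sum]
  ring

/-! ### Variation and mean square on the cells -/

/-- The total variation of `g` over the `k`-th level-`j` cell. -/
def cellVar (a b : ℝ) (g : ℝ → ℝ) (j k : ℕ) : ℝ := (eVariationOn g (cell a b j k)).toReal

lemma cellVar_nonneg (g : ℝ → ℝ) (j k : ℕ) : 0 ≤ cellVar a b g j k := ENNReal.toReal_nonneg

lemma abs_sub_le_cellVar {g : ℝ → ℝ} (hg : BoundedVariationOn g (Set.Icc a b)) {j k : ℕ} {x y : ℝ}
    (hx : x ∈ cell a b j k) (hy : y ∈ cell a b j k) : |g x - g y| ≤ cellVar a b g j k :=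
  (hg.mono (cell_subset_Icc a b j k)).dist_le hx hy

lemma sum_eVariationOn_cell_le (hab : a < b) (g : ℝ → ℝ) (j m : ℕ) :
    ∑ k ∈ Finset.range m, eVariationOn g (cell a b j k) ≤
      eVariationOn g {x ∈ Set.Ico a b | cellIndex a b j x < m} := by
  induction m with
  | zero => simp
  | succ m ih =>
    rw [Finset.sum_range_succ]
    refine (add_le_add_left ih _).trans ((eVariationOn.add_le_union g fun x hx y hy => ?_).trans
      (eVariationOn.mono g ?_))
    · by_contra hlt
      have h1 := cellIndex_mono hab j (not_le.1 hlt).le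
      have h2 : cellIndex a b j x < m := hx.2
      have h3 : cellIndex a b j y = m := hy.2
      omega
    · rintro x (⟨h1, h2⟩ | ⟨h1, h2⟩)
      · exact ⟨h1, h2.trans (Nat.lt_succ_self m)⟩
      · exact ⟨h1, h2 ▸ Nat.lt_succ_self _⟩

lemma sum_cellVar_le (hab : a < b) {g : ℝ → ℝ} (hg : BoundedVariationOn g (Set.Icc a b)) (j : ℕ) :
    ∑ k ∈ Finset.range (16 ^ j), cellVar a b g j k ≤ (eVariationOn g (Set.Icc a b)).toReal := by
  unfold cellVar
  rw [← ENNReal.toReal_sum fun k _ => hg.mono (cell_subset_Icc a b j k)]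
  refine ENNReal.toReal_mono hg
    ((sum_eVariationOn_cell_le hab g j _).trans (eVariationOn.mono g ?_))
  exact fun x hx => Set.Ico_subset_Icc_self hx.1

/-- Each cell contains a point where `g ^ 2` is at most its average over the cell. Sampling `g` at
such points gives step functions that are close to `g` and bounded in mean square by `g`. -/
lemma exists_mem_cell_sq_le (hab : a < b) {g : ℝ → ℝ}
    (hg2 : IntegrableOn (fun x => g x ^ 2) (Set.Icc a b)) {j k : ℕ} (hk : k < 16 ^ j) :
    ∃ y ∈ cell a b j k, g y ^ 2 ≤ 16 ^ j / (b - a) * ∫ x in cell a b j k, g x ^ 2 := by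
  have hba : 0 < b - a := sub_pos.2 hab
  have hv := volume_cell hab hk
  obtain ⟨y, hy, h⟩ := exists_le_setAverage (μ := volume) (s := cell a b j k)
    (f := fun x => g x ^ 2) (by rw [hv]; exact (ENNReal.ofReal_pos.2 (by positivity)).ne')
    (by rw [hv]; exact ENNReal.ofReal_ne_top) (hg2.mono_set (cell_subset_Icc a b j k))
  refine ⟨y, hy, h.trans_eq ?_⟩
  rw [setAverage_eq, smul_eq_mul, measureReal_def, hv, ENNReal.toReal_ofReal (by positivity),
    inv_div]

lemma sum_integral_cell_le {g : ℝ → ℝ} (hg2 : IntegrableOn (fun x => g x ^ 2) (Set.Icc a b))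
    (j : ℕ) : ∑ k ∈ Finset.range (16 ^ j), ∫ x in cell a b j k, g x ^ 2 ≤
      ∫ x in Set.Icc a b, g x ^ 2 := by
  rw [← integral_biUnion_finset _ (fun k _ => measurableSet_cell a b j k)
    (fun i _ j _ hij => pairwise_disjoint_cell _ _ _ hij)
    (fun k _ => hg2.mono_set (cell_subset_Icc a b j k))]
  exact setIntegral_mono_set hg2 (.of_forall fun x => sq_nonneg _)
    (Set.iUnion₂_subset fun k _ => cell_subset_Icc a b j k).eventuallyLE

lemma sum_range_mul_div (F : ℕ → ℝ) (m : ℕ) :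
    ∑ k ∈ Finset.range (16 * m), F (k / 16) = 16 * ∑ k ∈ Finset.range m, F k := by
  induction m with
  | zero => simp
  | succ m ih =>
    have h : ∑ k ∈ Finset.range 16, F ((16 * m + k) / 16) = 16 * F m := by
      rw [Finset.sum_congr rfl fun k hk => by
        rw [show (16 * m + k) / 16 = m by have := Finset.mem_range.1 hk; omega]]
      simp
    have h2 := Finset.sum_range_add (fun k => F (k / 16)) (16 * m) 16
    rw [Nat.mul_succ, h2, ih, h, Finset.sum_range_succ, mul_add]

/-! ### Chaining -/

lemma abs_sum_mul_le_of_sq {s : Finset ℕ} {c w : ℕ → ℝ} {r : ℕ} {R A T δ : ℝ} (hR : 0 ≤ R)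
    (hA : 0 ≤ A) (hT : 0 < T) (hδ : 0 ≤ δ) (hs : (s.card : ℝ) = 16 ^ r)
    (hc : ∑ k ∈ s, c k ^ 2 ≤ R * 16 ^ r * δ ^ 2)
    (hw : ∑ k ∈ s, (4 ^ r * w k) ^ 8 ≤ A * T ^ 8 * 16 ^ r) :
    |∑ k ∈ s, c k * w k| ≤ √(R * (1 + A)) * T * (δ * 4 ^ r) := by
  have h2 : ∑ k ∈ s, (4 ^ r * w k) ^ 2 ≤ (1 + A) * T ^ 2 * 16 ^ r := by
    have hpt : ∀ k ∈ s, (4 ^ r * w k) ^ 2 ≤ T ^ 2 + (4 ^ r * w k) ^ 8 / T ^ 6 := fun k _ => by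
      set D := 4 ^ r * w k
      rcases le_or_gt (D ^ 2) (T ^ 2) with h | h
      · have : 0 ≤ D ^ 8 / T ^ 6 := by positivity
        linarith
      · have h3 : T ^ 6 ≤ D ^ 6 := by
          have := pow_le_pow_left₀ (sq_nonneg T) h.le 3
          simpa only [← pow_mul] using this
        have : D ^ 2 ≤ D ^ 8 / T ^ 6 := by
          rw [le_div_iff₀ (by positivity)]
          calc D ^ 2 * T ^ 6 ≤ D ^ 2 * D ^ 6 := by gcongr
            _ = D ^ 8 := by ring
        linarith [sq_nonneg T]
    refine (Finset.sum_le_sum hpt).trans ?_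
    rw [Finset.sum_add_distrib, ← Finset.sum_div, Finset.sum_const, nsmul_eq_mul, hs]
    have : (∑ k ∈ s, (4 ^ r * w k) ^ 8) / T ^ 6 ≤ A * T ^ 2 * 16 ^ r := by
      rw [div_le_iff₀ (by positivity)]
      exact hw.trans_eq (by ring)
    linarith
  have h3 := Finset.sum_mul_sq_le_sq_mul_sq s c (fun k => 4 ^ r * w k)
  have h4 : ∑ k ∈ s, c k * (4 ^ r * w k) = 4 ^ r * ∑ k ∈ s, c k * w k := by
    rw [Finset.mul_sum]; exact Finset.sum_congr rfl fun k _ => by ring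
  rw [h4] at h3
  have h16 : (16 : ℝ) ^ r = (4 ^ r) ^ 2 := by rw [← pow_mul, mul_comm, pow_mul]; norm_num
  have h5 : (4 ^ r * ∑ k ∈ s, c k * w k) ^ 2 ≤
      (4 ^ r * (√(R * (1 + A)) * T * (δ * 4 ^ r))) ^ 2 := by
    refine h3.trans ((mul_le_mul hc h2 (Finset.sum_nonneg fun k _ => sq_nonneg _)
      (by positivity)).trans_eq ?_)
    have := Real.sq_sqrt (show 0 ≤ R * (1 + A) by positivity)
    rw [h16]
    calc _ = (R * (1 + A)) * (T * δ * (4 ^ r) ^ 2) ^ 2 := by ring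
      _ = √(R * (1 + A)) ^ 2 * (T * δ * (4 ^ r) ^ 2) ^ 2 := by rw [this]
      _ = _ := by ring
  have h6 := abs_le_of_sq_le_sq h5 (by positivity)
  rw [abs_mul, abs_of_pos (by positivity : (0 : ℝ) < 4 ^ r)] at h6
  exact le_of_mul_le_mul_left h6 (by positivity)

/-- Interpolation between the `ℓ¹` and the `ℓ²` bound on the increments `d`, through the pointwise
inequality `|D| ≤ τ + D ^ 4 / τ ^ 3`. An eighth moment of the deviations suffices for the gain
`2 ^ (-l)` at distance `l` from the base level, which the second moment alone would not give. -/
lemma abs_sum_increment_mul_le {s : Finset ℕ} {d w : ℕ → ℝ} {r l : ℕ} {R A T δ M : ℝ} (hR : 0 ≤ R)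
    (hA : 0 ≤ A) (hT : 0 < T) (hδ : 0 ≤ δ) (hM : δ * 16 ^ r ≤ M)
    (hd1 : ∑ k ∈ s, |d k| ≤ 16 * M) (hd2 : ∑ k ∈ s, d k ^ 2 ≤ 4 * R * 16 ^ (r + l + 1) * δ ^ 2)
    (hw : ∑ k ∈ s, (4 ^ (r + l + 1) * w k) ^ 8 ≤ A * T ^ 8 * 16 ^ (r + l + 1)) :
    |∑ k ∈ s, d k * w k| ≤ 4 * (1 + 2 * √(R * A)) * T * (M / 4 ^ r) * (1 / 2) ^ l := by
  set τ : ℝ := T * 2 ^ l with hτ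
  have hτ0 : 0 < τ := by positivity
  set q : ℝ := 4 ^ (r + l + 1) with hq
  have hq0 : 0 < q := by positivity
  have hq2 : (16 : ℝ) ^ (r + l + 1) = q ^ 2 := by
    rw [hq, ← pow_mul, mul_comm, pow_mul]; norm_num
  have hpt : ∀ k ∈ s, |d k * (q * w k)| ≤ τ * |d k| + |d k| * (q * w k) ^ 4 / τ ^ 3 := fun k _ => by
    rw [abs_mul]
    set D := q * w k
    have h1 : |D| ≤ τ + D ^ 4 / τ ^ 3 := by
      rcases le_or_gt |D| τ with h | h
      · have : 0 ≤ D ^ 4 / τ ^ 3 := by positivity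
        linarith
      · have : |D| ≤ D ^ 4 / τ ^ 3 := by
          rw [le_div_iff₀ (by positivity), show D ^ 4 = |D| * |D| ^ 3 by
            rw [← pow_succ', Even.pow_abs (by decide)]]
          gcongr
        linarith
    calc |d k| * |D| ≤ |d k| * (τ + D ^ 4 / τ ^ 3) := by gcongr
      _ = _ := by ring
  have h4 : ∑ k ∈ s, |d k| * (q * w k) ^ 4 ≤ 2 * √(R * A) * T ^ 4 * (δ * q ^ 2) := by
    have h5 := Finset.sum_mul_sq_le_sq_mul_sq s (fun k => |d k|) (fun k => (q * w k) ^ 4)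
    refine le_of_sq_le_sq (h5.trans ?_) (by positivity)
    simp only [sq_abs, ← pow_mul]
    norm_num
    rw [hq2] at hd2 hw
    refine (mul_le_mul hd2 hw (Finset.sum_nonneg fun k _ => by positivity)
      (by positivity)).trans_eq ?_
    have := Real.sq_sqrt (show 0 ≤ R * A by positivity)
    calc _ = (R * A) * (2 * T ^ 4 * (δ * q ^ 2)) ^ 2 := by ring
      _ = √(R * A) ^ 2 * (2 * T ^ 4 * (δ * q ^ 2)) ^ 2 := by rw [this]
      _ = _ := by ring
  have hδq : δ * q ^ 2 ≤ 16 * 16 ^ l * M := by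
    rw [← hq2]
    calc δ * 16 ^ (r + l + 1) = 16 * 16 ^ l * (δ * 16 ^ r) := by ring
      _ ≤ _ := by gcongr
  have h6 : q * |∑ k ∈ s, d k * w k| ≤ τ * (16 * M) +
      2 * √(R * A) * T ^ 4 * (16 * 16 ^ l * M) / τ ^ 3 := by
    calc q * |∑ k ∈ s, d k * w k| = |∑ k ∈ s, d k * (q * w k)| := by
          rw [← abs_of_pos hq0, ← abs_mul, abs_of_pos hq0, Finset.mul_sum]
          congr 1
          exact Finset.sum_congr rfl fun k _ => by ring
      _ ≤ ∑ k ∈ s, |d k * (q * w k)| := Finset.abs_sum_le_sum_abs _ _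
      _ ≤ _ := Finset.sum_le_sum hpt
      _ = τ * ∑ k ∈ s, |d k| + (∑ k ∈ s, |d k| * (q * w k) ^ 4) / τ ^ 3 := by
          rw [Finset.sum_add_distrib, Finset.mul_sum, Finset.sum_div]
      _ ≤ _ := by
          gcongr
          exact h4.trans (by gcongr)
  have h2l : (0 : ℝ) < 2 ^ l := by positivity
  have h4r : (0 : ℝ) < 4 ^ r := by positivity
  have e16 : (16 : ℝ) ^ l = (2 ^ l) ^ 4 := by rw [← pow_mul, mul_comm, pow_mul]; norm_num
  have e4 : (4 : ℝ) ^ l = (2 ^ l) ^ 2 := by rw [← pow_mul, mul_comm, pow_mul]; norm_num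
  have hq' : q = 4 * (4 ^ r * (2 ^ l) ^ 2) := by rw [hq, pow_succ', pow_add, e4]
  refine le_of_mul_le_mul_left (h6.trans_eq ?_) hq0
  rw [hq', hτ, e16, one_div, inv_pow]
  field_simp
  ring

/-- What is left of `g` below the finest level is bounded by the variation of `g` on the cells. -/
lemma abs_empDev_sub_stepFun_le (hab : a < b) {P : Measure ℝ} [IsProbabilityMeasure P]
    (hP : ∀ᵐ y ∂P, y ∈ Set.Ico a b) {n : ℕ} {x : Fin n → ℝ} (hx : ∀ i, x i ∈ Set.Ico a b)
    {g : ℝ → ℝ} (hg : BoundedVariationOn g (Set.Icc a b)) (hgi : Integrable g P) {j : ℕ}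
    {y : ℕ → ℝ} (hy : ∀ k < 16 ^ j, y k ∈ cell a b j k) {B : ℝ}
    (hB : ∀ k < 16 ^ j, |empDev P x ((cell a b j k).indicator 1)| +
      2 * (√(n : ℝ) * P.real (cell a b j k)) ≤ B) :
    |empDev P x (fun t => g t - stepFun a b j (fun k => g (y k)) t)| ≤
      B * (eVariationOn g (Set.Icc a b)).toReal := by
  set V := stepFun a b j (cellVar a b g j) with hV
  set u : ℝ → ℝ := fun t => g t - stepFun a b j (fun k => g (y k)) t with hu
  have hB0 : 0 ≤ B := le_trans (by positivity) (hB 0 (by positivity))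
  have huV : ∀ t ∈ Set.Ico a b, |u t| ≤ V t := fun t ht => by
    rw [hu, hV]
    simp only [stepFun_apply hab _ _ ht]
    exact abs_sub_le_cellVar hg ⟨ht, rfl⟩ (hy _ (cellIndex_lt hab j ht))
  have hui : Integrable u P := hgi.sub (integrable_stepFun P j _)
  have h1 : |empMean x u| ≤ empMean x V := by
    rw [empMean, empMean, abs_mul, abs_of_nonneg (by positivity)]
    gcongr
    exact (Finset.abs_sum_le_sum_abs _ _).trans (Finset.sum_le_sum fun i _ => huV _ (hx i))
  have h2 : |∫ t, u t ∂P| ≤ ∫ t, V t ∂P :=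
    abs_integral_le_integral_abs.trans (integral_mono_ae hui.abs (integrable_stepFun P j _)
      (hP.mono fun t ht => huV t ht))
  have h3 : ∫ t, V t ∂P =
      ∑ k ∈ Finset.range (16 ^ j), cellVar a b g j k * P.real (cell a b j k) := by
    rw [hV]
    unfold stepFun
    rw [integral_finsetSum _ fun k _ => (integrable_indicator_cell P j k).const_mul _]
    refine Finset.sum_congr rfl fun k _ => ?_
    rw [integral_const_mul, integral_indicator_one (measurableSet_cell a b j k)]
  have h4 : |empDev P x u| ≤ empDev P x V + 2 * (√(n : ℝ) * ∫ t, V t ∂P) := by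
    rw [empDev, empDev, abs_mul, abs_of_nonneg (Real.sqrt_nonneg _)]
    have : |empMean x u - ∫ t, u t ∂P| ≤ empMean x V + ∫ t, V t ∂P :=
      (abs_sub _ _).trans (add_le_add h1 h2)
    have := mul_le_mul_of_nonneg_left this (Real.sqrt_nonneg (n : ℝ))
    linarith
  refine h4.trans ?_
  rw [hV, empDev_stepFun, ← hV, h3, Finset.mul_sum, Finset.mul_sum, ← Finset.sum_add_distrib]
  calc _ ≤ ∑ k ∈ Finset.range (16 ^ j), B * cellVar a b g j k := by
        refine Finset.sum_le_sum fun k hk => ?_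
        have h5 := hB k (Finset.mem_range.1 hk)
        have h6 := le_abs_self (empDev P x ((cell a b j k).indicator 1))
        have h7 := mul_le_mul_of_nonneg_left
          ((add_le_add_left h6 _).trans h5) (cellVar_nonneg (a := a) (b := b) g j k)
        linarith
    _ ≤ _ := by
        rw [← Finset.mul_sum]
        exact mul_le_mul_of_nonneg_left (sum_cellVar_le hab hg j) hB0

/-- The constant of the chaining bound. -/
def chainConst (R A C : ℝ) : ℝ := √(R * (1 + A)) + 8 * (1 + 2 * √(R * A)) + (A + 8 * C)

/-- Deterministic chaining bound: if the cell deviations have eighth moments of size `T ^ 8` at all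
levels up to `N`, then the empirical process at a function of variation `M` and mean square
`δ ^ 2` is at most of order `T * M / 4 ^ r`, where `16 ^ r` is at most `M / δ`. -/
lemma abs_empDev_le_of_moments (hab : a < b) {P : Measure ℝ} [IsProbabilityMeasure P]
    (hP : ∀ᵐ y ∂P, y ∈ Set.Ico a b) {n : ℕ} {x : Fin n → ℝ} (hx : ∀ i, x i ∈ Set.Ico a b)
    {g : ℝ → ℝ} (hg : BoundedVariationOn g (Set.Icc a b)) (hgi : Integrable g P)
    (hg2 : IntegrableOn (fun x => g x ^ 2) (Set.Icc a b)) {R A C T δ M : ℝ} (hR : 0 ≤ R)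
    (hA : 1 ≤ A) (hC : 0 ≤ C) (hT : 1 ≤ T) (hδ : 0 ≤ δ)
    (hPC : ∀ j, ∀ k < 16 ^ j, P.real (cell a b j k) ≤ C / 16 ^ j)
    (hgM : (eVariationOn g (Set.Icc a b)).toReal ≤ M)
    (hgδ : (∫ x in Set.Icc a b, g x ^ 2) / (b - a) ≤ R * δ ^ 2) {r N : ℕ} (hM : δ * 16 ^ r ≤ M)
    (hrN : 3 * r ≤ N) (hN : n < 16 ^ (N + 1))
    (hw : ∀ j ≤ N, ∑ k ∈ Finset.range (16 ^ j),
      (4 ^ j * empDev P x ((cell a b j k).indicator 1)) ^ 8 ≤ A * T ^ 8 * 16 ^ j) :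
    |empDev P x g| ≤ chainConst R A C * (T * (M / 4 ^ r)) := by
  have hba : 0 < b - a := sub_pos.2 hab
  have hM0 : 0 ≤ M := ENNReal.toReal_nonneg.trans hgM
  have hT0 : 0 < T := by linarith
  choose! y hy hysq using fun (j k : ℕ) (hk : k < 16 ^ j) => exists_mem_cell_sq_le hab hg2 hk
  set c : ℕ → ℕ → ℝ := fun j k => g (y j k) with hc
  set w : ℕ → ℕ → ℝ := fun j k => empDev P x ((cell a b j k).indicator 1) with hwdef
  have hcsq : ∀ j, ∑ k ∈ Finset.range (16 ^ j), c j k ^ 2 ≤ R * 16 ^ j * δ ^ 2 := fun j => by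
    calc _ ≤ ∑ k ∈ Finset.range (16 ^ j), 16 ^ j / (b - a) * ∫ x in cell a b j k, g x ^ 2 :=
          Finset.sum_le_sum fun k hk => hysq j k (Finset.mem_range.1 hk)
      _ ≤ 16 ^ j / (b - a) * ∫ x in Set.Icc a b, g x ^ 2 := by
          rw [← Finset.mul_sum]
          gcongr
          exact sum_integral_cell_le hg2 j
      _ = 16 ^ j * ((∫ x in Set.Icc a b, g x ^ 2) / (b - a)) := by ring
      _ ≤ 16 ^ j * (R * δ ^ 2) := by gcongr
      _ = _ := by ring
  have hbase : |empDev P x (stepFun a b r (c r))| ≤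
      √(R * (1 + A)) * T * (M / 4 ^ r) := by
    rw [empDev_stepFun]
    refine (abs_sum_mul_le_of_sq hR (by linarith) hT0 hδ (by simp) (hcsq r)
      (hw r (by omega))).trans ?_
    gcongr
    rw [le_div_iff₀ (by positivity)]
    calc δ * 4 ^ r * 4 ^ r = δ * 16 ^ r := by rw [mul_assoc, ← mul_pow]; norm_num
      _ ≤ M := hM
  have hincr : ∀ l ∈ Finset.range (N - r), |empDev P x (stepFun a b (r + l + 1) (c (r + l + 1))) -
      empDev P x (stepFun a b (r + l) (c (r + l)))| ≤
        4 * (1 + 2 * √(R * A)) * T * (M / 4 ^ r) * (1 / 2) ^ l := fun l hl => by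
    have hl' := Finset.mem_range.1 hl
    rw [← empDev_sub P x (integrable_stepFun P _ _) (integrable_stepFun P _ _),
      stepFun_succ_sub hab, empDev_stepFun]
    have hpow : (16 : ℕ) ^ (r + l + 1) = 16 * 16 ^ (r + l) := by ring
    refine abs_sum_increment_mul_le hR (by linarith) hT0 hδ hM ?_ ?_ (hw _ (by omega))
    · calc _ ≤ ∑ k ∈ Finset.range (16 ^ (r + l + 1)), cellVar a b g (r + l) (k / 16) := by
            refine Finset.sum_le_sum fun k hk => ?_
            have hk' := Finset.mem_range.1 hk
            exact abs_sub_le_cellVar hg (cell_succ_subset a b _ k (hy _ k hk'))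
              (hy _ _ (by omega))
        _ = 16 * ∑ k ∈ Finset.range (16 ^ (r + l)), cellVar a b g (r + l) k := by
            rw [hpow, sum_range_mul_div]
        _ ≤ 16 * M := by
            gcongr
            exact (sum_cellVar_le hab hg _).trans hgM
    · calc _ ≤ ∑ k ∈ Finset.range (16 ^ (r + l + 1)),
              (2 * c (r + l + 1) k ^ 2 + 2 * c (r + l) (k / 16) ^ 2) :=
            Finset.sum_le_sum fun k _ => by
              nlinarith [sq_nonneg (c (r + l + 1) k + c (r + l) (k / 16))]
        _ = 2 * ∑ k ∈ Finset.range (16 ^ (r + l + 1)), c (r + l + 1) k ^ 2 +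
              2 * (16 * ∑ k ∈ Finset.range (16 ^ (r + l)), c (r + l) k ^ 2) := by
            rw [Finset.sum_add_distrib, ← Finset.mul_sum, ← Finset.mul_sum]
            congr 2
            rw [hpow, sum_range_mul_div (fun k => c (r + l) k ^ 2)]
        _ ≤ 2 * (R * 16 ^ (r + l + 1) * δ ^ 2) + 2 * (16 * (R * 16 ^ (r + l) * δ ^ 2)) := by
            gcongr <;> exact hcsq _
        _ = _ := by ring
  have hrem : |empDev P x (fun t => g t - stepFun a b N (c N) t)| ≤
      (A + 8 * C) * T * (M / 4 ^ r) := by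
    have h2N : (0 : ℝ) < 2 ^ N := by positivity
    have e4 : (4 : ℝ) ^ N = (2 ^ N) ^ 2 := by rw [← pow_mul, mul_comm, pow_mul]; norm_num
    have e16 : (16 : ℝ) ^ N = (2 ^ N) ^ 4 := by rw [← pow_mul, mul_comm, pow_mul]; norm_num
    have h1N : (1 : ℝ) ≤ 2 ^ N := one_le_pow₀ (by norm_num)
    have hB : ∀ k < 16 ^ N, |w N k| + 2 * (√(n : ℝ) * P.real (cell a b N k)) ≤
        (A + 8 * C) * T / 2 ^ N := fun k hk => by
      have h1 : |w N k| ≤ A * T / 2 ^ N := by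
        have h8 : (4 ^ N * w N k) ^ 8 ≤ (A * T * 2 ^ N) ^ 8 := by
          refine (Finset.single_le_sum (f := fun k => (4 ^ N * w N k) ^ 8)
            (fun _ _ => by positivity) (Finset.mem_range.2 hk)).trans ((hw N le_rfl).trans ?_)
          rw [mul_pow, mul_pow, e16]
          gcongr
          · exact le_self_pow₀ hA (by norm_num)
          · norm_num
        rw [← Even.pow_abs (by decide)] at h8
        have h9 := (pow_le_pow_iff_left₀ (abs_nonneg _) (by positivity) (by norm_num)).1 h8
        rw [abs_mul, abs_of_pos (show (0 : ℝ) < 4 ^ N by positivity), e4] at h9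
        rw [le_div_iff₀ h2N]
        refine le_of_mul_le_mul_left ?_ h2N
        linarith
      have h2 : √(n : ℝ) ≤ 4 * 4 ^ N := by
        refine Real.sqrt_le_iff.2 ⟨by positivity, ?_⟩
        calc (n : ℝ) ≤ 16 ^ (N + 1) := by exact_mod_cast hN.le
          _ = (4 * 4 ^ N) ^ 2 := by rw [pow_succ, e16, e4]; ring
      have h3 : 2 * (√(n : ℝ) * P.real (cell a b N k)) ≤ 8 * C * T / 2 ^ N := by
        calc _ ≤ 2 * (4 * 4 ^ N * (C / 16 ^ N)) := by
              gcongr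
              exact hPC N k hk
          _ = 8 * C / (2 ^ N * 2 ^ N) := by rw [e4, e16]; field_simp; ring
          _ ≤ 8 * C * T / (2 ^ N * 1) :=
              div_le_div₀ (by positivity) (le_mul_of_one_le_right (by positivity) hT)
                (by positivity) (by gcongr)
          _ = _ := by rw [mul_one]
      calc _ ≤ A * T / 2 ^ N + 8 * C * T / 2 ^ N := add_le_add h1 h3
        _ = _ := by ring
    refine (abs_empDev_sub_stepFun_le hab hP hx hg hgi (hy N) hB).trans ?_
    have h4r : (4 : ℝ) ^ r ≤ 2 ^ N := by
      rw [show (4 : ℝ) = 2 ^ 2 by norm_num, ← pow_mul]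
      exact pow_le_pow_right₀ (by norm_num) (by omega)
    calc _ ≤ (A + 8 * C) * T / 4 ^ r * M := by gcongr
      _ = _ := by ring
  have htel : empDev P x g = empDev P x (fun t => g t - stepFun a b N (c N) t) +
      (empDev P x (stepFun a b r (c r)) + ∑ l ∈ Finset.range (N - r),
        (empDev P x (stepFun a b (r + l + 1) (c (r + l + 1))) -
          empDev P x (stepFun a b (r + l) (c (r + l))))) := by
    have h1 := Finset.sum_range_sub (fun l => empDev P x (stepFun a b (r + l) (c (r + l)))) (N - r)
    simp only [← add_assoc, add_zero] at h1
    rw [h1, empDev_sub P x hgi (integrable_stepFun P _ _), show r + (N - r) = N by omega]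
    ring
  rw [htel]
  refine (abs_add_le _ _).trans ?_
  have hsum : |∑ l ∈ Finset.range (N - r),
        (empDev P x (stepFun a b (r + l + 1) (c (r + l + 1))) -
          empDev P x (stepFun a b (r + l) (c (r + l))))| ≤
      8 * (1 + 2 * √(R * A)) * T * (M / 4 ^ r) := by
    refine (Finset.abs_sum_le_sum_abs _ _).trans ((Finset.sum_le_sum hincr).trans ?_)
    rw [← Finset.mul_sum]
    have := summable_geometric_two.sum_le_tsum (Finset.range (N - r)) fun i _ => by positivity
    rw [tsum_geometric_two] at this
    calc _ ≤ 4 * (1 + 2 * √(R * A)) * T * (M / 4 ^ r) * 2 := by gcongr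
      _ = _ := by ring
  refine (add_le_add hrem ((abs_add_le _ _).trans (add_le_add hbase hsum))).trans_eq ?_
  rw [chainConst]
  ring

/-! ### Densities of log-bounded variation -/

variable {f f₀ : ℝ → ℝ}

lemma lt_of_mem_densities (hf : f ∈ densities a b) : a < b := by
  obtain ⟨g, ⟨-, hg⟩, -⟩ := hf
  by_contra h
  have h0 : volume.restrict (Set.Icc a b) = 0 := by
    rw [Measure.restrict_eq_zero, Real.volume_Icc, ENNReal.ofReal_eq_zero]
    linarith
  simp [h0] at hg

lemma pos_of_mem_densities (hf : f ∈ densities a b) (x : ℝ) : 0 < f x := by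
  obtain ⟨g, -, rfl⟩ := hf
  exact Real.exp_pos _

lemma boundedVariationOn_log (hf : f ∈ densities a b) :
    BoundedVariationOn (fun x => Real.log (f x)) (Set.Icc a b) := by
  obtain ⟨g, ⟨hg, -⟩, rfl⟩ := hf
  simpa only [Real.log_exp] using hg

lemma integral_of_mem_densities (hf : f ∈ densities a b) : ∫ x in Set.Icc a b, f x = 1 := by
  obtain ⟨g, ⟨-, hg⟩, rfl⟩ := hf
  exact hg

lemma integrableOn_of_mem_densities (hf : f ∈ densities a b) : IntegrableOn f (Set.Icc a b) := by
  by_contra h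
  have := integral_of_mem_densities hf
  rw [integral_undef h] at this
  exact zero_ne_one this

lemma exists_bounds_of_mem_densities (hf : f ∈ densities a b) :
    ∃ c C : ℝ, 0 < c ∧ 0 < C ∧ ∀ x ∈ Set.Icc a b, c ≤ f x ∧ f x ≤ C := by
  have ha : a ∈ Set.Icc a b := Set.left_mem_Icc.2 (lt_of_mem_densities hf).le
  refine ⟨Real.exp (Real.log (f a) - I a b f), Real.exp (Real.log (f a) + I a b f),
    Real.exp_pos _, Real.exp_pos _, fun x hx => ?_⟩
  have h := abs_le.1 ((boundedVariationOn_log hf).dist_le hx ha)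
  change -I a b f ≤ _ ∧ _ ≤ I a b f at h
  rw [← Real.le_log_iff_exp_le (pos_of_mem_densities hf x),
    ← Real.log_le_iff_le_exp (pos_of_mem_densities hf x)]
  constructor <;> linarith

lemma isProbabilityMeasure_law (hf : f ∈ densities a b) : IsProbabilityMeasure (law a b f) := by
  constructor
  rw [law, withDensity_apply _ MeasurableSet.univ, Measure.restrict_univ,
    ← ofReal_integral_eq_lintegral_ofReal (integrableOn_of_mem_densities hf)
      (.of_forall fun x => (pos_of_mem_densities hf x).le), integral_of_mem_densities hf,
    ENNReal.ofReal_one]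

lemma law_absolutelyContinuous : law a b f ≪ volume.restrict (Set.Icc a b) :=
  withDensity_absolutelyContinuous _ _

lemma ae_law_mem_Ico : ∀ᵐ y ∂(law a b f), y ∈ Set.Ico a b := by
  have h : ∀ᵐ y ∂(volume.restrict (Set.Icc a b)), y ∈ Set.Ico a b := by
    rw [← restrict_Ico_eq_restrict_Icc]
    exact ae_restrict_mem measurableSet_Ico
  exact law_absolutelyContinuous.ae_le h

lemma law_real_cell_le (hab : a < b) {C : ℝ} (hC : 0 ≤ C) (hf : ∀ x ∈ Set.Icc a b, f x ≤ C)
    {j k : ℕ} (hk : k < 16 ^ j) : (law a b f).real (cell a b j k) ≤ C * (b - a) / 16 ^ j := by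
  have hba : 0 < b - a := sub_pos.2 hab
  rw [mul_div_assoc]
  refine ENNReal.toReal_le_of_le_ofReal (by positivity) ?_
  rw [law, withDensity_apply _ (measurableSet_cell a b j k),
    Measure.restrict_restrict (measurableSet_cell a b j k),
    Set.inter_eq_left.2 (cell_subset_Icc a b j k)]
  calc _ ≤ ∫⁻ _ in cell a b j k, ENNReal.ofReal C :=
        setLIntegral_mono measurable_const fun x hx =>
          ENNReal.ofReal_le_ofReal (hf x (cell_subset_Icc a b j k hx))
    _ = _ := by rw [setLIntegral_const, volume_cell hab hk, ENNReal.ofReal_mul hC]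

/-! ### The functions `p_f` -/

lemma log_exp_add_exp_le (u v u' v' : ℝ) :
    Real.log (Real.exp u + Real.exp v) ≤
      Real.log (Real.exp u' + Real.exp v') + (|u - u'| + |v - v'|) := by
  have hpos : 0 < Real.exp u' + Real.exp v' := add_pos (Real.exp_pos _) (Real.exp_pos _)
  rw [Real.log_le_iff_le_exp (add_pos (Real.exp_pos _) (Real.exp_pos _)), Real.exp_add,
    Real.exp_log hpos, add_mul, ← Real.exp_add, ← Real.exp_add]
  have h1 := le_abs_self (u - u')
  have h2 := le_abs_self (v - v')
  have h3 := abs_nonneg (u - u')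
  have h4 := abs_nonneg (v - v')
  gcongr <;> linarith

lemma abs_log_exp_add_exp_sub_le (u v u' v' : ℝ) :
    |Real.log (Real.exp u + Real.exp v) - Real.log (Real.exp u' + Real.exp v')| ≤
      |u - u'| + |v - v'| := by
  have h1 := log_exp_add_exp_le u v u' v'
  have h2 := log_exp_add_exp_le u' v' u v
  rw [abs_sub_comm u' u, abs_sub_comm v' v] at h2
  exact abs_le.2 ⟨by linarith, by linarith⟩

lemma pFun_eq (hf₀ : ∀ x, 0 < f₀ x) (hf : ∀ x, 0 < f x) (x : ℝ) :
    pFun f₀ f x = (1 / 2) * (Real.log (Real.exp (Real.log (f x)) + Real.exp (Real.log (f₀ x))) -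
      Real.log 2 - Real.log (f₀ x)) := by
  have h0 := hf₀ x
  have h := hf x
  rw [pFun, Real.exp_log h, Real.exp_log h0, Real.log_div (by positivity) (by positivity),
    Real.log_mul (by norm_num) h0.ne']
  ring

lemma edist_pFun_le (hf₀ : ∀ x, 0 < f₀ x) (hf : ∀ x, 0 < f x) (x y : ℝ) :
    edist (pFun f₀ f x) (pFun f₀ f y) ≤ edist (Real.log (f x)) (Real.log (f y)) +
      edist (Real.log (f₀ x)) (Real.log (f₀ y)) := by
  simp only [edist_dist, Real.dist_eq]
  rw [← ENNReal.ofReal_add (abs_nonneg _) (abs_nonneg _)]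
  refine ENNReal.ofReal_le_ofReal ?_
  rw [pFun_eq hf₀ hf, pFun_eq hf₀ hf]
  have h1 := abs_le.1 (abs_log_exp_add_exp_sub_le (Real.log (f x)) (Real.log (f₀ x))
    (Real.log (f y)) (Real.log (f₀ y)))
  have h2 := abs_le.1 (le_refl |Real.log (f₀ x) - Real.log (f₀ y)|)
  have h3 := abs_nonneg (Real.log (f x) - Real.log (f y))
  exact abs_le.2 ⟨by linarith [h1.1, h2.2], by linarith [h1.2, h2.1]⟩

lemma eVariationOn_pFun_le (hf₀ : ∀ x, 0 < f₀ x) (hf : ∀ x, 0 < f x) (s : Set ℝ) :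
    eVariationOn (pFun f₀ f) s ≤ eVariationOn (fun x => Real.log (f x)) s +
      eVariationOn (fun x => Real.log (f₀ x)) s := by
  refine iSup_le fun p => ?_
  refine (Finset.sum_le_sum fun i _ => edist_pFun_le hf₀ hf _ _).trans ?_
  rw [Finset.sum_add_distrib]
  exact add_le_add (eVariationOn.sum_le p.2.2.1 p.2.2.2) (eVariationOn.sum_le p.2.2.1 p.2.2.2)

lemma boundedVariationOn_pFun (hf₀ : f₀ ∈ densities a b) (hf : f ∈ densities a b) :
    BoundedVariationOn (pFun f₀ f) (Set.Icc a b) :=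
  ((eVariationOn_pFun_le (pos_of_mem_densities hf₀) (pos_of_mem_densities hf) _).trans_lt
    (ENNReal.add_lt_top.2 ⟨(boundedVariationOn_log hf).lt_top,
      (boundedVariationOn_log hf₀).lt_top⟩)).ne

lemma eVariationOn_pFun_toReal_le_J (hf₀ : f₀ ∈ densities a b) (hf : f ∈ densities a b) :
    (eVariationOn (pFun f₀ f) (Set.Icc a b)).toReal ≤ J a b f₀ f := by
  have h := ENNReal.toReal_mono
    (ENNReal.add_ne_top.2 ⟨boundedVariationOn_log hf, boundedVariationOn_log hf₀⟩)
    (eVariationOn_pFun_le (pos_of_mem_densities hf₀) (pos_of_mem_densities hf) (Set.Icc a b))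
  rw [ENNReal.toReal_add (boundedVariationOn_log hf) (boundedVariationOn_log hf₀)] at h
  rw [J, I, I]
  linarith

lemma abs_log_half_sq_add_one_le {t : ℝ} (ht : 0 ≤ t) : |Real.log ((t ^ 2 + 1) / 2)| ≤ |t - 1| := by
  have hpos : 0 < (t ^ 2 + 1) / 2 := by positivity
  rw [abs_le, Real.le_log_iff_exp_le hpos, Real.log_le_iff_le_exp hpos]
  rcases le_total 1 t with h | h
  · rw [abs_of_nonneg (sub_nonneg.2 h)]
    constructor
    · exact (Real.exp_le_one_iff.2 (by linarith)).trans (by nlinarith)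
    · have := Real.quadratic_le_exp_of_nonneg (sub_nonneg.2 h)
      nlinarith
  · rw [abs_of_nonpos (by linarith), neg_neg]
    constructor
    · have h1 := Real.quadratic_le_exp_of_nonneg (sub_nonneg.2 h)
      have h2 : Real.exp (t - 1) = (Real.exp (1 - t))⁻¹ := by rw [← Real.exp_neg, neg_sub]
      rw [h2, inv_le_comm₀ (Real.exp_pos _) hpos]
      refine le_trans ?_ h1
      rw [inv_le_iff_one_le_mul₀ hpos]
      nlinarith [sq_nonneg ((1 - t) ^ 2)]
    · calc (t ^ 2 + 1) / 2 ≤ 1 := by nlinarith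
        _ ≤ _ := Real.one_le_exp (by linarith)

lemma four_mul_pFun_sq_le {x : ℝ} (h₀ : 0 < f₀ x) (h : 0 < f x) :
    4 * f₀ x * pFun f₀ f x ^ 2 ≤ (√(f x) - √(f₀ x)) ^ 2 := by
  have hs₀ : 0 < √(f₀ x) := Real.sqrt_pos.2 h₀
  have e₀ : √(f₀ x) ^ 2 = f₀ x := Real.sq_sqrt h₀.le
  have e : √(f x) ^ 2 = f x := Real.sq_sqrt h.le
  have hlog := abs_log_half_sq_add_one_le (t := √(f x) / √(f₀ x)) (by positivity)
  have harg : ((√(f x) / √(f₀ x)) ^ 2 + 1) / 2 = (f x + f₀ x) / (2 * f₀ x) := by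
    rw [div_pow, e, e₀]; field_simp
  rw [harg] at hlog
  have h1 := sq_le_sq.2 hlog
  rw [pFun]
  calc _ = √(f₀ x) ^ 2 * Real.log ((f x + f₀ x) / (2 * f₀ x)) ^ 2 := by rw [e₀]; ring
    _ ≤ √(f₀ x) ^ 2 * (√(f x) / √(f₀ x) - 1) ^ 2 := by gcongr
    _ = _ := by rw [← mul_pow, mul_sub, mul_div_cancel₀ _ hs₀.ne', mul_one]

lemma aestronglyMeasurable_pFun (hf₀ : f₀ ∈ densities a b) (hf : f ∈ densities a b) :
    AEStronglyMeasurable (pFun f₀ f) (volume.restrict (Set.Icc a b)) := by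
  have h₀ := (integrableOn_of_mem_densities hf₀).aestronglyMeasurable.aemeasurable
  have h := (integrableOn_of_mem_densities hf).aestronglyMeasurable.aemeasurable
  exact (((h.add h₀).div (h₀.const_mul 2)).log.const_mul _).aestronglyMeasurable

lemma exists_abs_pFun_le (hf₀ : f₀ ∈ densities a b) (hf : f ∈ densities a b) :
    ∃ C, ∀ x ∈ Set.Icc a b, |pFun f₀ f x| ≤ C := by
  have ha : a ∈ Set.Icc a b := Set.left_mem_Icc.2 (lt_of_mem_densities hf).le
  refine ⟨|pFun f₀ f a| + (eVariationOn (pFun f₀ f) (Set.Icc a b)).toReal, fun x hx => ?_⟩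
  have h := (boundedVariationOn_pFun hf₀ hf).dist_le hx ha
  rw [Real.dist_eq] at h
  have := abs_sub_abs_le_abs_sub (pFun f₀ f x) (pFun f₀ f a)
  linarith

lemma integrable_pFun_law (hf₀ : f₀ ∈ densities a b) (hf : f ∈ densities a b) :
    Integrable (pFun f₀ f) (law a b f₀) := by
  have := isProbabilityMeasure_law hf₀
  obtain ⟨C, hC⟩ := exists_abs_pFun_le hf₀ hf
  exact Integrable.of_bound ((aestronglyMeasurable_pFun hf₀ hf).mono_ac law_absolutelyContinuous) C
    (ae_law_mem_Ico.mono fun x hx => hC x (Set.Ico_subset_Icc_self hx))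

lemma integrableOn_pFun_sq (hf₀ : f₀ ∈ densities a b) (hf : f ∈ densities a b) :
    IntegrableOn (fun x => pFun f₀ f x ^ 2) (Set.Icc a b) := by
  obtain ⟨C, hC⟩ := exists_abs_pFun_le hf₀ hf
  refine Integrable.of_bound ((aestronglyMeasurable_pFun hf₀ hf).pow 2) (C ^ 2)
    ((ae_restrict_mem measurableSet_Icc).mono fun x hx => ?_)
  rw [norm_pow]
  exact pow_le_pow_left₀ (norm_nonneg _) (hC x hx) 2

lemma sqrt_sub_sqrt_sq_le {u v : ℝ} (hu : 0 ≤ u) (hv : 0 ≤ v) : (√u - √v) ^ 2 ≤ u + v := by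
  nlinarith [Real.sq_sqrt hu, Real.sq_sqrt hv, Real.sqrt_nonneg u, Real.sqrt_nonneg v,
    mul_nonneg (Real.sqrt_nonneg u) (Real.sqrt_nonneg v)]

lemma integrableOn_sqrt_sub_sq (hf₀ : f₀ ∈ densities a b) (hf : f ∈ densities a b) :
    IntegrableOn (fun x => (√(f x) - √(f₀ x)) ^ 2) (Set.Icc a b) := by
  have h₀ := integrableOn_of_mem_densities hf₀
  have h := integrableOn_of_mem_densities hf
  refine (h.add h₀).mono' ?_ (.of_forall fun x => ?_)
  · exact ((h.aestronglyMeasurable.aemeasurable.sqrt.sub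
      h₀.aestronglyMeasurable.aemeasurable.sqrt).pow_const 2).aestronglyMeasurable
  · rw [Real.norm_of_nonneg (sq_nonneg _)]
    exact sqrt_sub_sqrt_sq_le (pos_of_mem_densities hf x).le (pos_of_mem_densities hf₀ x).le

lemma hellinger_sq (a b : ℝ) (f f₀ : ℝ → ℝ) : hellinger a b f f₀ ^ 2 =
    (1 / 2) * ∫ x in Set.Icc a b, (√(f x) - √(f₀ x)) ^ 2 :=
  Real.sq_sqrt (mul_nonneg (by norm_num) (integral_nonneg fun x => sq_nonneg _))

lemma hellinger_le_one (hf₀ : f₀ ∈ densities a b) (hf : f ∈ densities a b) :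
    hellinger a b f f₀ ≤ 1 := by
  have h₀ := integrableOn_of_mem_densities hf₀
  have h := integrableOn_of_mem_densities hf
  have hnn : 0 ≤ hellinger a b f f₀ := Real.sqrt_nonneg _
  rw [← sq_le_one_iff₀ hnn, hellinger_sq]
  have : ∫ x in Set.Icc a b, (√(f x) - √(f₀ x)) ^ 2 ≤ ∫ x in Set.Icc a b, (f x + f₀ x) :=
    integral_mono (integrableOn_sqrt_sub_sq hf₀ hf) (h.add h₀) fun x =>
      sqrt_sub_sqrt_sq_le (pos_of_mem_densities hf x).le (pos_of_mem_densities hf₀ x).le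
  rw [integral_add h h₀, integral_of_mem_densities hf, integral_of_mem_densities hf₀] at this
  linarith

/-- The mean square of `p_f` is controlled by the squared Hellinger distance, because
`|log ((t ^ 2 + 1) / 2)| ≤ |t - 1|` for `t = √(f / f₀)`. -/
lemma integral_pFun_sq_le (hf₀ : f₀ ∈ densities a b) (hf : f ∈ densities a b) {c : ℝ} (hc : 0 < c)
    (hc₀ : ∀ x ∈ Set.Icc a b, c ≤ f₀ x) :
    ∫ x in Set.Icc a b, pFun f₀ f x ^ 2 ≤ 1 / (2 * c) * hellinger a b f f₀ ^ 2 := by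
  have h : ∫ x in Set.Icc a b, pFun f₀ f x ^ 2 ≤
      ∫ x in Set.Icc a b, 1 / (4 * c) * (√(f x) - √(f₀ x)) ^ 2 := by
    refine setIntegral_mono_on (integrableOn_pFun_sq hf₀ hf)
      ((integrableOn_sqrt_sub_sq hf₀ hf).const_mul _) measurableSet_Icc fun x hx => ?_
    rw [one_div, ← div_eq_inv_mul, le_div_iff₀ (by positivity)]
    refine le_trans ?_ (four_mul_pFun_sq_le (pos_of_mem_densities hf₀ x)
      (pos_of_mem_densities hf x))
    nlinarith [mul_le_mul_of_nonneg_right (hc₀ x hx) (sq_nonneg (pFun f₀ f x))]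
  rw [integral_const_mul] at h
  rw [hellinger_sq]
  refine h.trans_eq ?_
  field_simp
  ring

/-! ### The exceptional event and the tail bound -/

/-- The normalized deviation `16 ^ (j / 2) √n (P_n - P)` of the `k`-th level-`j` cell. -/
def cellDev (P : Measure ℝ) (a b : ℝ) {n : ℕ} (x : Fin n → ℝ) (j k : ℕ) : ℝ :=
  4 ^ j * empDev P x ((cell a b j k).indicator 1)

lemma measurable_cellDev (P : Measure ℝ) (a b : ℝ) (n j k : ℕ) :
    Measurable fun x : Fin n → ℝ => cellDev P a b x j k := by
  unfold cellDev empDev empMean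
  refine (((Finset.measurable_sum _ fun i _ => ?_).const_mul _).sub_const _).const_mul _
    |>.const_mul _
  exact (measurable_one.indicator (measurableSet_cell a b j k)).comp (measurable_pi_apply i)

/-- The samples for which, at some level `j` and some height `i`, too many cells have a
deviation above `T * (i + 1)` in absolute value. -/
def exceptionalSet (P : Measure ℝ) (a b : ℝ) (n : ℕ) (T : ℝ) : Set (Fin n → ℝ) :=
  {x | ∃ j i : ℕ, 16 ^ j ≤ n ∧
    ((16 : ℝ) ^ j / 2 ^ i < countAbove (16 ^ j) (T * (i + 1)) (fun k => cellDev P a b x j k) ∨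
      (16 : ℝ) ^ j / 2 ^ i < countAbove (16 ^ j) (T * (i + 1)) (fun k => -cellDev P a b x j k))}

lemma lintegral_prod_exp_cellDev_le {P : Measure ℝ} [IsProbabilityMeasure P] {n j : ℕ}
    (hn : 16 ^ j ≤ n) {C : ℝ} (hPC : ∀ k < 16 ^ j, P.real (cell a b j k) ≤ C / 16 ^ j)
    {e : ℝ} (he : |e| = 1) (S : Finset ℕ) (hS : S ⊆ Finset.range (16 ^ j)) :
    ∫⁻ x, ∏ k ∈ S, ENNReal.ofReal (Real.exp (e * cellDev P a b x j k))
        ∂(Measure.pi fun _ : Fin n => P) ≤ ENNReal.ofReal (Real.exp C) ^ S.card := by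
  have hs : √(((16 ^ j : ℕ) : ℝ)) = 4 ^ j := by
    rw [Real.sqrt_eq_iff_mul_self_eq (by positivity) (by positivity), ← mul_pow]
    norm_num
  have := lintegral_prod_exp_cell_le (P := P) (by positivity) hn (measurableSet_cell a b j)
    (pairwise_disjoint_cell a b j) (C := C) S
    (fun k hk => by
      push_cast
      exact hPC k (Finset.mem_range.1 (hS hk))) he
  rw [hs] at this
  exact this

lemma measure_exceptionalSet_le {P : Measure ℝ} [IsProbabilityMeasure P] (n : ℕ) {C T : ℝ}
    (hC : 0 ≤ C) (hPC : ∀ j, ∀ k < 16 ^ j, P.real (cell a b j k) ≤ C / 16 ^ j)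
    (hT : 2 * (1 + Real.exp C) ≤ T) :
    (Measure.pi fun _ : Fin n => P) (exceptionalSet P a b n T) ≤
      ENNReal.ofReal (8 * Real.exp (-T / 4)) := by
  set q : ℝ≥0∞ := ENNReal.ofReal (Real.exp (-T / 4)) with hq
  set E : ℕ → ℕ → Set (Fin n → ℝ) := fun j i => {x | 16 ^ j ≤ n ∧
    ((16 : ℝ) ^ j / 2 ^ i < countAbove (16 ^ j) (T * (i + 1)) (fun k => cellDev P a b x j k) ∨
      (16 : ℝ) ^ j / 2 ^ i < countAbove (16 ^ j) (T * (i + 1)) (fun k => -cellDev P a b x j k))}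
    with hE
  have hsub : exceptionalSet P a b n T ⊆ ⋃ j, ⋃ i, E j i := by
    rintro x ⟨j, i, h⟩
    exact Set.mem_iUnion₂.2 ⟨j, i, h⟩
  have hexp : ∀ i j : ℕ, ENNReal.ofReal (Real.exp (-(T * (i + j + 1) / 4))) ≤
      q * (2⁻¹ ^ i * 2⁻¹ ^ j) := fun i j => by
    have hT4 : 1 ≤ T / 4 := by linarith [Real.one_le_exp hC]
    have h2 : Real.exp (-T / 4) ≤ 2⁻¹ := by
      calc Real.exp (-T / 4) ≤ Real.exp (-1) := Real.exp_le_exp.2 (by linarith)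
        _ ≤ 2⁻¹ := by
            rw [Real.exp_neg]
            gcongr
            linarith [Real.add_one_le_exp 1]
    have h3 : Real.exp (-(T * (i + j + 1) / 4)) =
        Real.exp (-T / 4) * (Real.exp (-T / 4) ^ i * Real.exp (-T / 4) ^ j) := by
      rw [← Real.exp_nat_mul, ← Real.exp_nat_mul, ← Real.exp_add, ← Real.exp_add]
      congr 1
      ring
    have h4 : ENNReal.ofReal (Real.exp (-T / 4)) ≤ 2⁻¹ := by
      refine (ENNReal.ofReal_le_ofReal h2).trans_eq ?_
      rw [ENNReal.ofReal_inv_of_pos (by norm_num)]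
      norm_num
    rw [h3, ENNReal.ofReal_mul (Real.exp_pos _).le, ENNReal.ofReal_mul (by positivity),
      ENNReal.ofReal_pow (Real.exp_pos _).le, ENNReal.ofReal_pow (Real.exp_pos _).le, ← hq]
    gcongr
  have hEle : ∀ j i, (Measure.pi fun _ : Fin n => P) (E j i) ≤
      2 * (q * (2⁻¹ ^ i * 2⁻¹ ^ j)) := fun j i => by
    by_cases hn : 16 ^ j ≤ n
    · have hpos := measure_countAbove_gt_le (μ := Measure.pi fun _ : Fin n => P)
        (D := fun k x => cellDev P a b x j k) (fun k => measurable_cellDev P a b n j k) hC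
        (fun S hS => by
          simpa using lintegral_prod_exp_cellDev_le hn (hPC j) (e := 1) (by simp) S hS) i hT
      have hneg := measure_countAbove_gt_le (μ := Measure.pi fun _ : Fin n => P)
        (D := fun k x => -cellDev P a b x j k) (fun k => (measurable_cellDev P a b n j k).neg) hC
        (fun S hS => by
          simpa using lintegral_prod_exp_cellDev_le hn (hPC j) (e := -1) (by simp) S hS) i hT
      refine (measure_mono fun x hx => hx.2).trans ((measure_union_le _ _).trans
        ((add_le_add hpos hneg).trans ?_))
      rw [← two_mul]
      gcongr
      exact hexp i j
    · have : E j i = ∅ := Set.eq_empty_of_forall_notMem fun x hx => hn hx.1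
      simp [this]
  calc _ ≤ (Measure.pi fun _ : Fin n => P) (⋃ j, ⋃ i, E j i) := measure_mono hsub
    _ ≤ ∑' j, ∑' i, (Measure.pi fun _ : Fin n => P) (E j i) :=
        (measure_iUnion_le _).trans (ENNReal.tsum_le_tsum fun j => measure_iUnion_le _)
    _ ≤ ∑' j : ℕ, ∑' i : ℕ, 2 * (q * (2⁻¹ ^ i * 2⁻¹ ^ j)) :=
        ENNReal.tsum_le_tsum fun j => ENNReal.tsum_le_tsum fun i => hEle j i
    _ = 2 * (q * (2 * 2)) := by
        simp_rw [ENNReal.tsum_mul_left, ENNReal.tsum_mul_right, ENNReal.tsum_mul_left,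
          ENNReal.tsum_geometric_two]
    _ = _ := by
        rw [ENNReal.ofReal_mul (by norm_num), ← hq]
        norm_num
        ring

/-- Off the exceptional set the supremum is bounded. The level `r` where the chain starts is
adapted to `f`, with `16 ^ r` of the order of `J / h`. -/
lemma ratio_le_of_notMem_exceptionalSet (hf₀ : f₀ ∈ densities a b) {c C T : ℝ} (hc : 0 < c)
    (hc₀ : ∀ x ∈ Set.Icc a b, c ≤ f₀ x) (hC : 0 ≤ C)
    (hPC : ∀ j, ∀ k < 16 ^ j, (law a b f₀).real (cell a b j k) ≤ C / 16 ^ j) (hT : 1 ≤ T) {n : ℕ}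
    (hn : 1 ≤ n) {x : Fin n → ℝ} (hx : ∀ i, x i ∈ Set.Ico a b)
    (hxT : x ∉ exceptionalSet (law a b f₀) a b n T) (hf : f ∈ farDensities a b f₀ n) :
    ratio a b f₀ x f ≤ 4 * chainConst (1 / (2 * c * (b - a))) momentConst C * T := by
  obtain ⟨hf, hfar⟩ := hf
  have hab := lt_of_mem_densities hf₀
  have hba : 0 < b - a := sub_pos.2 hab
  have := isProbabilityMeasure_law hf₀
  set M := J a b f₀ f with hM
  set δ := hellinger a b f f₀ with hδ
  have hM1 : 1 ≤ M := by
    rw [hM, J, I, I]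
    have h1 : 0 ≤ (eVariationOn (fun x => Real.log (f x)) (Set.Icc a b)).toReal :=
      ENNReal.toReal_nonneg
    have h2 : 0 ≤ (eVariationOn (fun x => Real.log (f₀ x)) (Set.Icc a b)).toReal :=
      ENNReal.toReal_nonneg
    linarith
  have hM0 : 0 < M := by linarith
  have hn0 : (0 : ℝ) < n := Nat.cast_pos.2 hn
  have hδ0 : 0 < δ := lt_trans (mul_pos (Real.rpow_pos_of_pos hn0 _) hM0) hfar
  have hδ1 : δ ≤ 1 := hellinger_le_one hf₀ hf
  have hMδ : 1 ≤ M / δ := (one_le_div hδ0).2 (hδ1.trans hM1)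
  have hcube : (M / δ) ^ 3 < (n : ℝ) := by
    have h1 : M / δ < (n : ℝ) ^ (1 / 3 : ℝ) := by
      rw [Real.rpow_neg hn0.le, inv_mul_lt_iff₀ (Real.rpow_pos_of_pos hn0 _)] at hfar
      exact (div_lt_iff₀ hδ0).2 hfar
    calc (M / δ) ^ 3 < ((n : ℝ) ^ (1 / 3 : ℝ)) ^ 3 := by gcongr
      _ = (n : ℝ) := by
          rw [← Real.rpow_natCast, ← Real.rpow_mul hn0.le]
          norm_num
  set r := Nat.log 16 ⌊M / δ⌋₊ with hr
  set N := Nat.log 16 n with hN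
  have hfl : ⌊M / δ⌋₊ ≠ 0 := (Nat.floor_pos.2 hMδ).ne'
  have hr1 : (16 : ℝ) ^ r ≤ M / δ := by
    have h1 : 16 ^ r ≤ ⌊M / δ⌋₊ := Nat.pow_log_le_self 16 hfl
    have h2 := (Nat.le_floor_iff (by positivity)).1 h1
    exact_mod_cast h2
  have hr2 : M / δ < 16 ^ (r + 1) := by
    have h1 : ⌊M / δ⌋₊ < 16 ^ (r + 1) := Nat.lt_pow_succ_log_self (by norm_num) _
    have h2 := (Nat.floor_lt (by positivity)).1 h1
    exact_mod_cast h2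
  have hrN : 3 * r ≤ N := by
    refine Nat.le_log_of_pow_le (by norm_num) ?_
    have h1 : (16 : ℝ) ^ (3 * r) ≤ n := by
      rw [mul_comm, pow_mul]
      exact (pow_le_pow_left₀ (by positivity) hr1 3).trans hcube.le
    exact_mod_cast h1
  have hδM : δ * 16 ^ r ≤ M := by
    rw [mul_comm]
    exact (le_div_iff₀ hδ0).1 hr1
  have hw : ∀ j ≤ N, ∑ k ∈ Finset.range (16 ^ j),
      (4 ^ j * empDev (law a b f₀) x ((cell a b j k).indicator 1)) ^ 8 ≤
        momentConst * T ^ 8 * 16 ^ j := fun j hj => by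
    have hjn : 16 ^ j ≤ n :=
      (Nat.pow_le_pow_right (by norm_num) hj).trans (Nat.pow_log_le_self 16 (by omega))
    refine sum_pow_eight_le (by linarith) (d := fun k => cellDev (law a b f₀) a b x j k)
      (fun i => ?_) fun i => ?_
    · by_contra h
      exact hxT ⟨j, i, hjn, Or.inl (not_le.1 h)⟩
    · by_contra h
      exact hxT ⟨j, i, hjn, Or.inr (not_le.1 h)⟩
  have hmain := abs_empDev_le_of_moments hab ae_law_mem_Ico hx
    (boundedVariationOn_pFun hf₀ hf) (integrable_pFun_law hf₀ hf) (integrableOn_pFun_sq hf₀ hf)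
    (R := 1 / (2 * c * (b - a))) (by positivity) one_le_momentConst hC hT hδ0.le hPC
    (eVariationOn_pFun_toReal_le_J hf₀ hf)
    (by
      rw [div_le_iff₀ hba]
      refine (integral_pFun_sq_le hf₀ hf hc hc₀).trans_eq ?_
      rw [← hδ]
      field_simp)
    hδM hrN (Nat.lt_pow_succ_log_self (by norm_num) n) hw
  have hK : 0 ≤ chainConst (1 / (2 * c * (b - a))) momentConst C := by
    have := one_le_momentConst
    rw [chainConst]
    positivity
  have hsqrt : M / 4 ^ r ≤ 4 * (√δ * √M) := by
    have h1 : √M ≤ 4 * 4 ^ r * √δ := by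
      refine Real.sqrt_le_iff.2 ⟨by positivity, ?_⟩
      rw [mul_pow, Real.sq_sqrt hδ0.le]
      calc M ≤ 16 ^ (r + 1) * δ := ((div_lt_iff₀ hδ0).1 hr2).le
        _ = (4 * 4 ^ r) ^ 2 * δ := by
            rw [← pow_succ', ← pow_mul, mul_comm (r + 1), pow_mul]; norm_num
    rw [div_le_iff₀ (by positivity)]
    calc M = √M * √M := (Real.mul_self_sqrt hM0.le).symm
      _ ≤ 4 * 4 ^ r * √δ * √M := by gcongr
      _ = _ := by ring
  rw [ratio, div_le_iff₀ (mul_pos (Real.sqrt_pos.2 hδ0) (Real.sqrt_pos.2 hM0))]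
  have habs : √(n : ℝ) * |empMean x (pFun f₀ f) - ∫ y, pFun f₀ f y ∂(law a b f₀)| =
      |empDev (law a b f₀) x (pFun f₀ f)| := by
    rw [empDev, abs_mul, abs_of_nonneg (Real.sqrt_nonneg _)]
  rw [habs]
  calc _ ≤ _ := hmain
    _ ≤ chainConst (1 / (2 * c * (b - a))) momentConst C * (T * (4 * (√δ * √M))) := by gcongr
    _ = _ := by ring

lemma measure_preimage_exceptionalSet_le {Ω : Type*} [MeasurableSpace Ω] {μ : Measure Ω}
    [IsProbabilityMeasure μ] {n : ℕ} {X : Fin n → Ω → ℝ} (hX : IsIIDSample a b f₀ μ X) {C T : ℝ}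
    (hf₀ : f₀ ∈ densities a b) (hC : 0 ≤ C)
    (hPC : ∀ j, ∀ k < 16 ^ j, (law a b f₀).real (cell a b j k) ≤ C / 16 ^ j)
    (hT : 2 * (1 + Real.exp C) ≤ T) :
    μ {ω | (fun i => X i ω) ∈ exceptionalSet (law a b f₀) a b n T} ≤
      ENNReal.ofReal (8 * Real.exp (-T / 4)) := by
  have := isProbabilityMeasure_law hf₀
  have hXm : ∀ i, AEMeasurable (X i) μ := fun i => (hX.hasLaw i).aemeasurable
  have hmap : μ.map (fun ω i => X i ω) = Measure.pi fun _ => law a b f₀ := by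
    rw [(iIndepFun_iff_map_fun_eq_pi_map hXm).1 hX.indep]
    congr 1
    funext i
    exact (hX.hasLaw i).map_eq
  refine (Measure.le_map_apply (aemeasurable_pi_lambda _ hXm) _).trans ?_
  rw [hmap]
  exact measure_exceptionalSet_le n hC hPC hT

theorem exists_tail_bound (hf₀ : f₀ ∈ densities a b) :
    ∃ (c : ℝ) (n₀ : ℕ) (t₀ : ℝ), 0 < c ∧
      ∀ n : ℕ, n₀ ≤ n → ∀ T : ℝ, t₀ ≤ T →
        ∀ (Ω : Type*) [MeasurableSpace Ω] (μ : Measure Ω) [IsProbabilityMeasure μ]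
          (X : Fin n → Ω → ℝ), IsIIDSample a b f₀ μ X →
          μ {ω | ENNReal.ofReal T ≤ supRatio a b f₀ (fun i => X i ω)} ≤
            ENNReal.ofReal (c * Real.exp (-T / c ^ 2)) := by
  obtain ⟨c₀, C₀, hc₀, hC₀, hbd⟩ := exists_bounds_of_mem_densities hf₀
  have hab := lt_of_mem_densities hf₀
  have hba : 0 < b - a := sub_pos.2 hab
  set C := C₀ * (b - a) with hC
  have hC0 : 0 ≤ C := by positivity
  have hPC : ∀ j, ∀ k < 16 ^ j, (law a b f₀).real (cell a b j k) ≤ C / 16 ^ j :=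
    fun j k hk => law_real_cell_le hab hC₀.le (fun x hx => (hbd x hx).2) hk
  set K := 4 * chainConst (1 / (2 * c₀ * (b - a))) momentConst C with hK
  have hK0 : 0 < K := by
    have := one_le_momentConst
    rw [hK, chainConst]
    positivity
  have hE : 0 < Real.exp C := Real.exp_pos C
  refine ⟨8 + 8 * K, 1, 2 * K * (2 * (1 + Real.exp C)), by positivity, ?_⟩
  intro n hn T hT Ω _ μ _ X hX
  have hT0 : 0 < T := lt_of_lt_of_le (by positivity) hT
  -- half of `T / K`, so that the bound `K * S` off the exceptional set is strictly below `T`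
  set S := T / (2 * K) with hS
  have hST : 2 * (1 + Real.exp C) ≤ S := by
    rw [hS, le_div_iff₀ (by positivity), mul_comm]
    exact hT
  have hKS : K * S < T := by
    rw [hS, show K * (T / (2 * K)) = T / 2 by field_simp]
    linarith
  have hsub : {ω | ENNReal.ofReal T ≤ supRatio a b f₀ (fun i => X i ω)} ⊆
      (⋃ i, {ω | ¬ X i ω ∈ Set.Ico a b}) ∪
        {ω | (fun i => X i ω) ∈ exceptionalSet (law a b f₀) a b n S} := by
    intro ω hω
    by_contra hcon
    rw [Set.mem_union, not_or] at hcon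
    have hin : ∀ i, X i ω ∈ Set.Ico a b := fun i => by
      by_contra h
      exact hcon.1 (Set.mem_iUnion.2 ⟨i, h⟩)
    have hle : supRatio a b f₀ (fun i => X i ω) ≤ ENNReal.ofReal (K * S) :=
      iSup₂_le fun f hf => ENNReal.ofReal_le_ofReal
        (ratio_le_of_notMem_exceptionalSet hf₀ hc₀ (fun x hx => (hbd x hx).1) hC0 hPC
          (by linarith) hn hin hcon.2 hf)
    exact absurd (hle.trans_lt ((ENNReal.ofReal_lt_ofReal_iff hT0).2 hKS)) (not_lt.2 hω)
  have hnull : μ (⋃ i, {ω | ¬ X i ω ∈ Set.Ico a b}) = 0 := by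
    refine measure_iUnion_null fun i => ?_
    have h := ae_law_mem_Ico (a := a) (b := b) (f := f₀)
    rw [← (hX.hasLaw i).map_eq] at h
    exact ae_of_ae_map (hX.hasLaw i).aemeasurable h
  refine (measure_mono hsub).trans ((measure_union_le _ _).trans ?_)
  rw [hnull, zero_add]
  refine (measure_preimage_exceptionalSet_le hX hf₀ hC0 hPC hST).trans
    (ENNReal.ofReal_le_ofReal ?_)
  have hexp : -S / 4 ≤ -T / (8 + 8 * K) ^ 2 := by
    rw [hS, neg_div, neg_div, neg_le_neg_iff, div_div]
    gcongr
    nlinarith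
  gcongr
  linarith

end FusedDensity

end

theorem mainTheorem5 (a b : ℝ) (f₀ : ℝ → ℝ) (hf₀ : f₀ ∈ FusedDensity.densities a b) :
    (∃ (c : ℝ) (n₀ : ℕ) (t₀ : ℝ), 0 < c ∧
      ∀ n : ℕ, n₀ ≤ n → ∀ T : ℝ, t₀ ≤ T →
        ∀ (Ω : Type*) [MeasurableSpace Ω] (μ : Measure Ω) [IsProbabilityMeasure μ]
          (X : Fin n → Ω → ℝ), FusedDensity.IsIIDSample a b f₀ μ X →
          μ {ω | ENNReal.ofReal T ≤ FusedDensity.supRatio a b f₀ (fun i => X i ω)} ≤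
            ENNReal.ofReal (c * Real.exp (-T / c ^ 2))) ∧
    (∀ (Ω : Type*) [MeasurableSpace Ω] (μ : Measure Ω) [IsProbabilityMeasure μ]
      (X : ℕ → Ω → ℝ), FusedDensity.IsIIDSample a b f₀ μ X →
      FusedDensity.IsBigOPOne μ
        (fun n ω => FusedDensity.supRatio a b f₀ (fun i : Fin n => X i ω))) := by
  refine ⟨FusedDensity.exists_tail_bound hf₀, fun Ω _ μ _ X hX ε hε => ?_⟩
  obtain ⟨c, n₀, t₀, hc, h⟩ := FusedDensity.exists_tail_bound hf₀
  have hlim : Filter.Tendsto (fun T : ℝ => c * Real.exp (-T / c ^ 2)) Filter.atTop (nhds 0) := by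
    have h1 : Filter.Tendsto (fun T : ℝ => -T / c ^ 2) Filter.atTop Filter.atBot :=
      Filter.tendsto_neg_atTop_atBot.atBot_div_const (by positivity)
    simpa using (Real.tendsto_exp_atBot.comp h1).const_mul c
  obtain ⟨T, hT, hTt⟩ := ((hlim.eventually_lt_const hε).and
    (Filter.eventually_ge_atTop t₀)).exists
  refine ⟨T.toNNReal, n₀, fun n hn => ?_⟩
  have hXn : FusedDensity.IsIIDSample a b f₀ μ (fun i : Fin n => X i) :=
    ⟨hX.indep.precomp Fin.val_injective, fun i => hX.hasLaw i⟩
  have hsub : {ω | (T.toNNReal : ℝ≥0∞) < FusedDensity.supRatio a b f₀ (fun i : Fin n => X i ω)} ⊆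
      {ω | ENNReal.ofReal T ≤ FusedDensity.supRatio a b f₀ (fun i : Fin n => X i ω)} :=
    Set.ofPred_subset_ofPred.2 fun ω hω => hω.le
  exact (measure_mono hsub).trans_lt
    ((h n hn T hTt Ω μ _ hXn).trans_lt
      ((ENNReal.ofReal_lt_ofReal_iff hε).2 hT))
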